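/- Let $M\ge 2$ and $r\ge 1$ be integers, let $m\ge 0$ be an integer, and let $a_1,\dots,a_r:\mathbb Z\to\mathbb C$ be finitely supported sequences (masks) with $\sum_{k\in\mathbb Z}a_\ell(k)=1$ for $\ell=1,\dots,r$. For a finitely supported $a:\mathbb Z\to\mathbb C$ write $\tilde a(z)=\sum_k a(k)z^k$ ($z\in\mathbb C\setminus\{0\}$), and for an integer $L\ge2$ and a sequence $v:\mathbb Z\to\mathbb C$ put $$[S_{a,L}v](j)=L\sum_{k\in\mathbb Z}v(k)\,a(j-Lk),\qquad [\nabla v](k)=v(k)-v(k-1).$$ Let $\delta$ be the Dirac sequence ($\delta(0)=1$ and $\delta(k)=0$ for $k\ne0$). For $a\neq 0$ let $\mathrm{sr}(a,L)$ be the largest integer $J\ge0$ such that $\tilde a(z)=(1+z+\cdots+z^{L-1})^J\,\tilde b(z)$ for some finitely supported $b$, and let $$\mathrm{sm}_\infty(a,L)=-\log_L\Big(\limsup_{n\to\infty}\big\|\nabla^{J}S_{a,L}^n\delta\big\|_{\ell_\infty}^{1/n}\Big),\qquad J=\mathrm{sr}(a,L).$$ For $v:\mathbb Z\to\mathbb C$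 let $v_0=v$ and let $v_n=S_{a_{\ell},M}v_{n-1}$ for $n\ge1$, where $\ell\in\{1,\dots,r\}$ and $\ell\equiv n \pmod r$; that is, the masks are applied in the cyclic order $a_1,\dots,a_r,a_1,\dots,a_r,\dots$. The quasi-stationary $M$-subdivision scheme with masks $a_1,\dots,a_r$ is called $C^m$-convergent if for every $v:\mathbb Z\to\mathbb C$ there is a function $\eta_v\in C^m(\mathbb R)$ such that for every $K>0$ and every $j=0,\dots,m$ $$\lim_{n\to\infty}\ \max_{k\in\mathbb Z\cap[-M^nK,\,M^nK]}\Big|M^{jn}[\nabla^j v_n](k)-\eta_v^{(j)}(M^{-n}k)\Big|=0.\qquad(*)$$ Let $a=M^{-r}S_{a_r,M}\cdots S_{a_1,M}\delta$, that is, $\tilde a(z)=\tilde a_1(z^{M^{r-1}})\cdots\tilde a_{r-1}(z^{M})\,\tilde a_r(z)$, and let $\phi$ be the compactly supported distribution given by $\hat\phi(\xi)=\prod_{j=1}^\infty\tilde a(e^{-iM^{-rj}\xi})$, $\xi\in\mathbb R$, where $\hat f(\xi)=\int_{\mathbb R}f(x)e^{-ix\xi}\,dx$ for integrable $f$ (the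 $M^r$-refinable function with mask $a$). **Theorem.** The quasi-stationary $M$-subdivision scheme with masks $a_1,\dots,a_r$ is $C^m$-convergent if and only if $$\mathrm{sm}_\infty(a,M^r)>m\qquad\text{and}\qquad \mathrm{sr}(a_\ell,M)>m\quad\text{for all }\ell=1,\dots,r.$$ Moreover, in this case $\phi\in C^m(\mathbb R)$, and for every $v:\mathbb Z\to\mathbb C$ the function $\eta_v$ in $(*)$ must be given by $\eta_v=\sum_{k\in\mathbb Z}v(k)\,\phi(\cdot-k)$. -/

import Mathlib

noncomputable section

namespace Subdivision

open Filter Topology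

/-- The Dirac sequence on `ℤ`. -/
def dirac : ℤ → ℂ := fun k => if k = 0 then 1 else 0

/-- The symbol `∑ a(k) z ^ k` of a finitely supported sequence `a` (a finite sum). -/
def symbol (a : ℤ → ℂ) (z : ℂ) : ℂ := ∑' k : ℤ, a k * z ^ k

/-- The `M`-subdivision operator `[S v](j) = M ∑ v(k) a(j - M k)`.
For a finitely supported `a` and `M ≠ 0` only finitely many terms are nonzero. -/
def subdiv (M : ℕ) (a v : ℤ → ℂ) : ℤ → ℂ :=
  fun j => (M : ℂ) * ∑' k : ℤ, v k * a (j - (M : ℤ) * k)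

/-- The backward difference operator. -/
def backDiff (v : ℤ → ℂ) : ℤ → ℂ := fun k => v k - v (k - 1)

/-- The mask `a` has order `J` sum rules with respect to `M`: its symbol is
`(1 + z + ⋯ + z ^ (M - 1)) ^ J` times the symbol of a finitely supported sequence. -/
def HasSumRules (a : ℤ → ℂ) (M J : ℕ) : Prop :=
  ∃ b : ℤ → ℂ, b.support.Finite ∧
    ∀ z : ℂ, z ≠ 0 → symbol a z = (∑ i ∈ Finset.range M, z ^ i) ^ J * symbol b z

/-- `sr(a, M)`, the largest order of the sum rules of `a` with respect to `M`.
The set of orders is bounded when `2 ≤ M` and `a` is a nonzero finitely supported sequence. -/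
def sr (a : ℤ → ℂ) (M : ℕ) : ℕ := sSup {J : ℕ | HasSumRules a M J}

/-- The supremum norm on bounded sequences. -/
def supNorm (v : ℤ → ℂ) : ℝ := ⨆ k : ℤ, ‖v k‖

/-- `ρ_J(a, M)_∞ = limsup_n ‖∇ ^ J S ^ n δ‖_∞ ^ (1 / n)`. For a finitely supported mask every
norm is finite, and the sequence of the roots is bounded. -/
def rhoInf (J : ℕ) (a : ℤ → ℂ) (M : ℕ) : ℝ :=
  limsup (fun n : ℕ => supNorm (backDiff^[J] ((subdiv M a)^[n] dirac)) ^ (1 / (n : ℝ))) atTop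

/-- `sm_∞(a, M) = - log_M ρ_J(a, M)_∞` with `J = sr(a, M)`. -/
def smInf (a : ℤ → ℂ) (M : ℕ) : ℝ := -Real.logb M (rhoInf (sr a M) a M)

/-- The data after `n` steps of the quasi-stationary scheme: the masks `a 0, …, a (r - 1)`
are applied cyclically, in this order, starting with `a 0`. -/
def qsData {r : ℕ} [NeZero r] (M : ℕ) (a : Fin r → ℤ → ℂ) (v : ℤ → ℂ) : ℕ → ℤ → ℂ
  | 0 => v
  | n + 1 => subdiv M (a (Fin.ofNat r n)) (qsData M a v n)

/-- The composite mask `M ^ (-r) S_{a (r - 1)} ⋯ S_{a 0} δ`. -/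
def compositeMask {r : ℕ} [NeZero r] (M : ℕ) (a : Fin r → ℤ → ℂ) : ℤ → ℂ :=
  fun k => ((M : ℂ) ^ r)⁻¹ * qsData M a dirac r k

/-- `η` is a `C^m` limit function of the quasi-stationary scheme for the initial sequence `v`:
for all `K > 0` and `j ≤ m`, the maximum over the integers `k` in `[-M ^ n K, M ^ n K]` of
`|M ^ (j n) [∇ ^ j v_n](k) - η^(j)(M ^ (-n) k)|` tends to `0` as `n → ∞`. -/
def IsLimitFunction {r : ℕ} [NeZero r] (M m : ℕ) (a : Fin r → ℤ → ℂ) (v : ℤ → ℂ)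
    (η : ℝ → ℂ) : Prop :=
  ContDiff ℝ m η ∧
    ∀ K : ℝ, 0 < K → ∀ j : ℕ, j ≤ m → ∀ ε : ℝ, 0 < ε → ∃ N : ℕ, ∀ n : ℕ, N ≤ n →
      ∀ k : ℤ, |(k : ℝ)| ≤ (M : ℝ) ^ n * K →
        ‖(M : ℂ) ^ (j * n) * (backDiff^[j] (qsData M a v n)) k
          - iteratedDeriv j η ((k : ℝ) / (M : ℝ) ^ n)‖ ≤ ε

/-- The quasi-stationary `M`-subdivision scheme with masks `a 0, …, a (r - 1)` is
`C^m`-convergent. -/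
def IsConvergent {r : ℕ} [NeZero r] (M m : ℕ) (a : Fin r → ℤ → ℂ) : Prop :=
  ∀ v : ℤ → ℂ, ∃ η : ℝ → ℂ, IsLimitFunction M m a v η

/-- The integrable function `φ` is the `M`-refinable function with mask `a`, normalized by
its Fourier transform: `∫ φ(x) e ^ (-i x ξ) dx = ∏_{j ≥ 1} symbol a (e ^ (-i M ^ (-j) ξ))`,
the infinite product being the limit of its partial products. -/
def IsRefinableFunction (M : ℕ) (a : ℤ → ℂ) (φ : ℝ → ℂ) : Prop :=
  MeasureTheory.Integrable φ ∧
    ∀ ξ : ℝ, Tendsto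
      (fun N : ℕ => ∏ j ∈ Finset.range N,
        symbol a (Complex.exp (-(Complex.I * ((ξ / (M : ℝ) ^ (j + 1) : ℝ) : ℂ)))))
      atTop (𝓝 (∫ x : ℝ, φ x * Complex.exp (-(Complex.I * (x : ℂ) * (ξ : ℂ)))))

end Subdivision

end

namespace Subdivision

open Filter Topology

/-! Sum rules of order J say that the mask is a J-fold box convolution of a finitely supported
quotient c (`hasSumRules_iff`). Since (1 - z)(1 + ... + z^(M-1)) = 1 - z^M, this gives ∇^J S_a = S_c
∇^J (`backDiff_iterate_subdiv_box`): J-th differences of the data are themselves data of a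
subdivision scheme, with the quotient masks.

Sufficiency. The smoothness condition makes differences of order sr(a, M^r) decay along whole
periods. Lowering the order of differencing keeps any rate slower than the natural one
(`decay_backDiff_of_decay_succ`), so ∇^(m+1) v_n decays like θ^n with θ < M^(-m)
(`exists_decay_of_smInf_sr`), and similarly ∇^(j+1) v_n for j ≤ m. By the sum rules, M^j ∇^j
v_{n+1}(Mq + g) differs from ∇^j v_n(q) by O(sup |∇^(j+1) v_n|). Hence for v = δ the rescaled j-th
differences converge uniformly to continuous functions f_j with f_j' = f_{j+1}. Other initial data
follow from locally finite superpositions of translates (`isConvergent_of_decay`).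

Necessity. Let φ be the limit function of δ. Its integral is 1 and its support is compact, so no
φ^(j), j ≤ m, vanishes identically. Comparing consecutive levels near a point where φ^(j) ≠ 0, along
the levels that use one given mask, forces all coset sums of the order-j quotient to agree, which
yields one more box factor (`IsLimitFunction.hasSumRules_succ`). Uniform continuity of φ^(m) gives
M^(mn) ∇^(m+1) v_n → 0. Those differences are iterated step-M^n differences of the quotient data,
whose support has length O(M^n), so the differencing can be undone at a cost independent of n. Some
fixed number of periods therefore contracts strictly better than M^(-m) per step
(`IsLimitFunction.exists_decay`).

The Fourier formula for φ comes from Riemann sums of φ(x) e^(-ixξ), which along whole periods are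
the partial products. -/

/-! ### Finite supports, differences and box convolution -/

/-- The sequence `a` vanishes outside `[-N, N]`. -/
def SuppIn (N : ℕ) (a : ℤ → ℂ) : Prop := ∀ k : ℤ, (N : ℤ) < |k| → a k = 0

/-- The backward difference with step `s`. -/
def shiftDiff (s : ℤ) (v : ℤ → ℂ) : ℤ → ℂ := fun k => v k - v (k - s)

/-- Convolution with the sequence whose symbol is `1 + z + ⋯ + z ^ (M - 1)`. -/
def box (M : ℕ) (v : ℤ → ℂ) : ℤ → ℂ := fun k => ∑ i ∈ Finset.range M, v (k - (i : ℤ))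

theorem backDiff_eq_shiftDiff : backDiff = shiftDiff 1 := rfl

theorem SuppIn.mono {N N' : ℕ} {a : ℤ → ℂ} (h : SuppIn N a) (hN : N ≤ N') : SuppIn N' a :=
  fun k hk => h k (lt_of_le_of_lt (by exact_mod_cast hN) hk)

theorem SuppIn.finite {N : ℕ} {a : ℤ → ℂ} (h : SuppIn N a) : (Function.support a).Finite := by
  refine (Set.finite_Icc (-(N : ℤ)) N).subset fun k hk => ?_
  by_contra hk'
  refine hk (h k ?_)
  rw [Set.mem_Icc, ← abs_le] at hk'
  exact not_le.mp hk'

theorem exists_suppIn {a : ℤ → ℂ} (h : (Function.support a).Finite) : ∃ N, SuppIn N a := by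
  obtain ⟨N, hN⟩ := (h.image (fun k : ℤ => k.natAbs)).bddAbove
  refine ⟨N, fun k hk => ?_⟩
  by_contra h0
  have : k.natAbs ≤ N := hN ⟨k, h0, rfl⟩
  rw [Int.abs_eq_natAbs] at hk
  omega

theorem SuppIn.tsum_eq {N : ℕ} {a : ℤ → ℂ} (h : SuppIn N a) :
    ∑' k, a k = ∑ k ∈ Finset.Icc (-(N : ℤ)) N, a k := by
  refine tsum_eq_sum fun k hk => h k ?_
  rw [Finset.mem_Icc, ← abs_le] at hk
  exact not_le.mp hk

theorem finite_support_shift {a : ℤ → ℂ} (h : (Function.support a).Finite) (s : ℤ) :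
    (Function.support fun k => a (k - s)).Finite :=
  h.preimage (f := fun k : ℤ => k - s) (sub_left_injective.injOn)

theorem finite_support_shiftDiff {a : ℤ → ℂ} (h : (Function.support a).Finite) (s : ℤ) :
    (Function.support (shiftDiff s a)).Finite :=
  (h.union (finite_support_shift h s)).subset (Function.support_sub _ _)

theorem finite_support_box {a : ℤ → ℂ} (h : (Function.support a).Finite) (M : ℕ) :
    (Function.support (box M a)).Finite := by
  refine (Set.Finite.biUnion (Finset.range M).finite_toSet
    fun i _ => finite_support_shift h (i : ℤ)).subset ?_
  exact Finset.support_sum _ _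

theorem finite_support_iterate {F : (ℤ → ℂ) → ℤ → ℂ}
    (hF : ∀ a : ℤ → ℂ, (Function.support a).Finite → (Function.support (F a)).Finite)
    {a : ℤ → ℂ} (h : (Function.support a).Finite) (J : ℕ) :
    (Function.support (F^[J] a)).Finite := by
  induction J with
  | zero => exact h
  | succ J ih => rw [Function.iterate_succ_apply']; exact hF _ ih

theorem finite_support_box_iterate {a : ℤ → ℂ} (h : (Function.support a).Finite) (M J : ℕ) :
    (Function.support ((box M)^[J] a)).Finite :=
  finite_support_iterate (fun _ ha => finite_support_box ha M) h J

theorem summable_subdiv {M : ℕ} (hM : 0 < M) {a : ℤ → ℂ} (h : (Function.support a).Finite)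
    (v : ℤ → ℂ) (j : ℤ) : Summable fun k : ℤ => v k * a (j - (M : ℤ) * k) := by
  refine summable_of_hasFiniteSupport ?_
  have hinj : Function.Injective fun k : ℤ => j - (M : ℤ) * k := by
    intro x y hxy
    have : (M : ℤ) * x = M * y := by simpa using hxy
    exact mul_left_cancel₀ (by exact_mod_cast hM.ne') this
  exact (h.preimage hinj.injOn).subset fun k hk hk' => hk (by simp_all)

/-- A telescoping sum; in symbols, (1 - z)(1 + ... + z^(M-1)) = 1 - z^M. -/
theorem shiftDiff_box (M : ℕ) (v : ℤ → ℂ) : backDiff (box M v) = shiftDiff M v := by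
  funext k
  have := Finset.sum_range_sub' (fun i : ℕ => v (k - (i : ℤ))) M
  simp only [backDiff, box, shiftDiff, ← Finset.sum_sub_distrib]
  simp only [Nat.cast_add, Nat.cast_one, Nat.cast_zero, sub_zero] at this
  rw [← this]
  refine Finset.sum_congr rfl fun i _ => ?_
  congr 2; ring

theorem backDiff_box_comm (M : ℕ) : Function.Commute backDiff (box M) := by
  intro v
  funext k
  simp only [backDiff, box, ← Finset.sum_sub_distrib]
  refine Finset.sum_congr rfl fun i _ => ?_
  congr 2; ring

theorem backDiff_iterate_box_iterate (M J : ℕ) (v : ℤ → ℂ) :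
    backDiff^[J] ((box M)^[J] v) = (shiftDiff M)^[J] v := by
  have h := (backDiff_box_comm M).comp_iterate J
  have h2 : backDiff ∘ box M = shiftDiff M := funext (shiftDiff_box M)
  rw [h2] at h
  rw [h]; rfl

theorem subdiv_shiftDiff {M : ℕ} (hM : 0 < M) {a : ℤ → ℂ} (h : (Function.support a).Finite)
    (v : ℤ → ℂ) (s : ℤ) :
    subdiv M a (shiftDiff s v) = shiftDiff (M * s) (subdiv M a v) := by
  funext j
  simp only [subdiv, shiftDiff, sub_mul]
  have h1 : Summable fun k : ℤ => v (k - s) * a (j - (M : ℤ) * k) :=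
    summable_subdiv hM h (fun k => v (k - s)) j
  rw [(summable_subdiv hM h v j).tsum_sub h1, mul_sub]
  congr 2
  rw [← (Equiv.addRight s).tsum_eq]
  refine tsum_congr fun k => ?_
  simp only [Equiv.coe_addRight, add_sub_cancel_right]
  congr 2; ring

theorem subdiv_box_mask {M : ℕ} (hM : 0 < M) {a : ℤ → ℂ} (h : (Function.support a).Finite)
    (v : ℤ → ℂ) : subdiv M (box M a) v = box M (subdiv M a v) := by
  funext j
  simp only [subdiv, box, Finset.mul_sum]
  rw [Summable.tsum_finsetSum, Finset.mul_sum]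
  · refine Finset.sum_congr rfl fun i _ => ?_
    congr 1
    refine tsum_congr fun k => ?_
    congr 2; ring
  · intro i _
    refine (summable_subdiv hM h v (j - i)).congr fun k => ?_
    congr 2; ring

theorem backDiff_subdiv_box {M : ℕ} (hM : 0 < M) {a : ℤ → ℂ} (h : (Function.support a).Finite)
    (v : ℤ → ℂ) : backDiff (subdiv M (box M a) v) = subdiv M a (backDiff v) := by
  rw [subdiv_box_mask hM h, shiftDiff_box, backDiff_eq_shiftDiff, subdiv_shiftDiff hM h, mul_one]

/-- Subdivision turns a unit-step difference of the input into a step-M difference of the output,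
and each box factor of the mask converts ∇ into exactly such a step-M difference. -/
theorem backDiff_iterate_subdiv_box {M : ℕ} (hM : 0 < M) {c : ℤ → ℂ}
    (h : (Function.support c).Finite) (J : ℕ) (v : ℤ → ℂ) :
    backDiff^[J] (subdiv M ((box M)^[J] c) v) = subdiv M c (backDiff^[J] v) := by
  induction J generalizing v with
  | zero => rfl
  | succ J ih =>
    rw [Function.iterate_succ_apply, Function.iterate_succ_apply', Function.iterate_succ_apply,
      backDiff_subdiv_box hM (finite_support_box_iterate h M J), ih]

theorem eq_zero_of_backDiff_eq_zero {v : ℤ → ℂ} (h : (Function.support v).Finite)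
    (h0 : backDiff v = 0) : v = 0 := by
  obtain ⟨N, hN⟩ := exists_suppIn h
  have hstep : ∀ k, v k = v (k - 1) := fun k => sub_eq_zero.mp (congrFun h0 k)
  have : ∀ (n : ℕ) (k : ℤ), v k = v (k - n) := by
    intro n
    induction n with
    | zero => intro k; simp
    | succ n ih => intro k; rw [ih k, hstep]; congr 1; push_cast; ring
  funext k
  rw [this (N + k.natAbs + 1 + k.natAbs) k]
  apply hN
  push_cast
  rw [lt_abs]; right
  have := abs_nonneg k
  have := le_abs_self k
  linarith

theorem backDiff_iterate_injective {v w : ℤ → ℂ} (hv : (Function.support v).Finite)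
    (hw : (Function.support w).Finite) (J : ℕ) (h : backDiff^[J] v = backDiff^[J] w) : v = w := by
  induction J generalizing v w with
  | zero => exact h
  | succ J ih =>
    have h1 := ih (finite_support_shiftDiff hv 1) (finite_support_shiftDiff hw 1) h
    have h2 : v - w = 0 := by
      refine eq_zero_of_backDiff_eq_zero ((hv.union hw).subset (Function.support_sub _ _)) ?_
      funext k
      have := congrFun h1 k
      simp only [shiftDiff] at this
      simp only [backDiff, Pi.sub_apply, Pi.zero_apply]
      linear_combination this
    exact sub_eq_zero.mp h2

/-! ### Symbols and sum rules -/

theorem symbol_shift (a : ℤ → ℂ) (s : ℤ) {z : ℂ} (hz : z ≠ 0) :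
    symbol (fun k => a (k - s)) z = z ^ s * symbol a z := by
  unfold symbol
  rw [← tsum_mul_left, ← (Equiv.addRight s).tsum_eq]
  refine tsum_congr fun k => ?_
  simp only [Equiv.coe_addRight, add_sub_cancel_right, zpow_add₀ hz]
  ring

theorem summable_symbol {a : ℤ → ℂ} (h : (Function.support a).Finite) (z : ℂ) :
    Summable fun k : ℤ => a k * z ^ k :=
  summable_of_hasFiniteSupport (h.subset fun k hk hk' => hk (by simp_all))

theorem symbol_sub {a b : ℤ → ℂ} (ha : (Function.support a).Finite)
    (hb : (Function.support b).Finite) (z : ℂ) :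
    symbol (a - b) z = symbol a z - symbol b z := by
  unfold symbol
  rw [← (summable_symbol ha z).tsum_sub (summable_symbol hb z)]
  exact tsum_congr fun k => by simp [sub_mul]

theorem symbol_box {a : ℤ → ℂ} (h : (Function.support a).Finite) (M : ℕ) {z : ℂ} (hz : z ≠ 0) :
    symbol (box M a) z = (∑ i ∈ Finset.range M, z ^ i) * symbol a z := by
  have h1 : symbol (box M a) z = ∑ i ∈ Finset.range M, symbol (fun k => a (k - (i : ℤ))) z := by
    simp only [symbol, box, Finset.sum_mul]
    exact Summable.tsum_finsetSum fun i _ => summable_symbol (finite_support_shift h i) z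
  rw [h1, Finset.sum_mul]
  exact Finset.sum_congr rfl fun i _ => by rw [symbol_shift a i hz, zpow_natCast]

theorem symbol_box_iterate {a : ℤ → ℂ} (h : (Function.support a).Finite) (M J : ℕ) {z : ℂ}
    (hz : z ≠ 0) :
    symbol ((box M)^[J] a) z = (∑ i ∈ Finset.range M, z ^ i) ^ J * symbol a z := by
  induction J with
  | zero => simp
  | succ J ih =>
    rw [Function.iterate_succ_apply', symbol_box (finite_support_box_iterate h M J) M hz, ih]
    ring

/-- Multiplying by z^N turns the symbol into a polynomial with infinitely many roots. -/
theorem eq_zero_of_symbol_eq_zero {a : ℤ → ℂ} (h : (Function.support a).Finite)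
    (h0 : ∀ z : ℂ, z ≠ 0 → symbol a z = 0) : a = 0 := by
  obtain ⟨N, hN⟩ := exists_suppIn h
  set p : Polynomial ℂ :=
    ∑ i ∈ Finset.range (2 * N + 1), Polynomial.monomial i (a ((i : ℤ) - N)) with hp
  have hroot : ∀ z : ℂ, z ≠ 0 → p.IsRoot z := by
    intro z hz
    have hs : symbol (fun k => a (k - N)) z = 0 := by rw [symbol_shift a _ hz, h0 z hz, mul_zero]
    have : p.eval z = symbol (fun k => a (k - N)) z := by
      rw [hp, Polynomial.eval_finsetSum]
      simp only [Polynomial.eval_monomial, symbol]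
      rw [tsum_eq_sum (s := (Finset.range (2 * N + 1)).map Nat.castEmbedding)]
      · simp
      · intro k hk
        rw [hN, zero_mul]
        by_contra hlt
        refine hk ?_
        rw [not_lt, abs_le] at hlt
        simp only [Finset.mem_map, Finset.mem_range, Nat.castEmbedding_apply]
        exact ⟨k.toNat, by omega, by omega⟩
    rw [Polynomial.IsRoot, this, hs]
  have hp0 : p = 0 := by
    refine Polynomial.eq_zero_of_infinite_isRoot p
      (Set.Infinite.mono (s := {0}ᶜ) (fun z hz => hroot z hz) ?_)
    exact (Set.finite_singleton (0 : ℂ)).infinite_compl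
  funext k
  by_cases hk : (N : ℤ) < |k|
  · exact hN k hk
  · rw [not_lt, abs_le] at hk
    have hc : p.coeff (k + N).toNat = 0 := by rw [hp0]; simp
    rw [hp, Polynomial.finsetSum_coeff] at hc
    simp only [Polynomial.coeff_monomial] at hc
    rw [Finset.sum_ite_eq', if_pos (by rw [Finset.mem_range]; omega)] at hc
    rw [Pi.zero_apply, ← hc]
    congr 1; omega

/-- Finitely supported sequences are determined by their symbols, so the factorization can be
handled on sequences; from here on sum rules are used mainly in this form. -/
theorem hasSumRules_iff {a : ℤ → ℂ} (h : (Function.support a).Finite) (M J : ℕ) :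
    HasSumRules a M J ↔ ∃ c : ℤ → ℂ, (Function.support c).Finite ∧ a = (box M)^[J] c := by
  constructor
  · rintro ⟨b, hb, hab⟩
    refine ⟨b, hb, sub_eq_zero.mp ?_⟩
    have hb' := finite_support_box_iterate hb M J
    refine eq_zero_of_symbol_eq_zero ((h.union hb').subset (Function.support_sub _ _)) ?_
    intro z hz
    rw [symbol_sub h hb', hab z hz, symbol_box_iterate hb M J hz, sub_self]
  · rintro ⟨c, hc, rfl⟩
    exact ⟨c, hc, fun z hz => symbol_box_iterate hc M J hz⟩

theorem HasSumRules.mono {a : ℤ → ℂ} {M J J' : ℕ} (h : (Function.support a).Finite)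
    (hJ : HasSumRules a M J) (hle : J' ≤ J) : HasSumRules a M J' := by
  rw [hasSumRules_iff h] at hJ ⊢
  obtain ⟨c, hc, rfl⟩ := hJ
  refine ⟨(box M)^[J - J'] c, finite_support_box_iterate hc M _, ?_⟩
  rw [← Function.iterate_add_apply, Nat.add_sub_cancel' hle]

/-- The extreme coefficients of a convolution cannot cancel, so a box lengthens the support by M - 1
≥ 1; only a gain of one at the right end is recorded. -/
theorem eq_zero_outside_of_box {M : ℕ} (hM : 2 ≤ M) {b : ℤ → ℂ}
    (hb : (Function.support b).Finite) {A B : ℤ}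
    (h : ∀ k, (k < A ∨ B < k) → box M b k = 0) :
    ∀ k, (k < A ∨ B - 1 < k) → b k = 0 := by
  intro k hk
  by_contra hbk
  have hne : hb.toFinset.Nonempty := ⟨k, by simpa using hbk⟩
  rcases hk with hk | hk
  · have hmin := hb.toFinset.min'_mem hne
    set k₀ := hb.toFinset.min' hne with hk0
    have hle : k₀ ≤ k := Finset.min'_le _ _ (by simpa using hbk)
    have h1 := h k₀ (Or.inl (by omega))
    rw [box, Finset.sum_eq_single 0] at h1
    · simp only [Nat.cast_zero, sub_zero] at h1
      exact (by simpa using hmin : b k₀ ≠ 0) h1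
    · intro i _ hi
      by_contra hbi
      have := Finset.min'_le hb.toFinset (k₀ - i) (by simpa using hbi)
      omega
    · intro h0; simp at h0; omega
  · have hmax := hb.toFinset.max'_mem hne
    set k₀ := hb.toFinset.max' hne with hk0
    have hle : k ≤ k₀ := Finset.le_max' _ _ (by simpa using hbk)
    have h1 := h (k₀ + (M - 1 : ℕ)) (Or.inr (by omega))
    rw [box, Finset.sum_eq_single (M - 1)] at h1
    · simp only [add_sub_cancel_right] at h1
      exact (by simpa using hmax : b k₀ ≠ 0) h1
    · intro i hi hi'
      rw [Finset.mem_range] at hi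
      by_contra hbi
      have := Finset.le_max' hb.toFinset (k₀ + (M - 1 : ℕ) - i) (by simpa using hbi)
      omega
    · intro h0; simp at h0; omega

/-- Each box factor removed shortens the support window by at least one. Without this bound the
supremum defining `sr` would carry no information. -/
theorem bddAbove_sumRules {a : ℤ → ℂ} {M : ℕ} (hM : 2 ≤ M) (h : (Function.support a).Finite)
    (h0 : a ≠ 0) : BddAbove {J : ℕ | HasSumRules a M J} := by
  obtain ⟨N, hN⟩ := exists_suppIn h
  refine ⟨2 * N + 1, fun J hJ => ?_⟩
  obtain ⟨c, hc, rfl⟩ := (hasSumRules_iff h M J).mp hJ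
  by_contra hlt
  have key : ∀ (J : ℕ) (B : ℤ), (∀ k, (k < -(N : ℤ) ∨ B < k) → (box M)^[J] c k = 0) →
      ∀ k, (k < -(N : ℤ) ∨ B - J < k) → c k = 0 := by
    intro J
    induction J with
    | zero => intro B hB k hk; exact hB k (by simpa using hk)
    | succ J ih =>
      intro B hB k hk
      refine ih (B - 1) ?_ k (by push_cast at hk; rcases hk with hk | hk <;> omega)
      rw [Function.iterate_succ_apply'] at hB
      exact eq_zero_outside_of_box hM (finite_support_box_iterate hc M J) hB
  have hc0 : c = 0 := by
    funext k
    refine key J N (fun k hk => hN k ?_) k ?_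
    · rw [lt_abs]; omega
    · omega
  apply h0
  rw [hc0]
  clear * -
  induction J with
  | zero => rfl
  | succ J ih => rw [Function.iterate_succ_apply', ih]; funext k; simp [box]

theorem lt_sr_iff {a : ℤ → ℂ} {M : ℕ} (hM : 2 ≤ M) (h : (Function.support a).Finite)
    (h0 : a ≠ 0) (m : ℕ) : m < sr a M ↔ HasSumRules a M (m + 1) := by
  have hb := bddAbove_sumRules hM h h0
  constructor
  · intro hlt
    have hmem : sr a M ∈ {J : ℕ | HasSumRules a M J} :=
      Nat.sSup_mem ⟨0, show HasSumRules a M 0 from ⟨a, h, fun z _ => by simp⟩⟩ hb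
    exact HasSumRules.mono h hmem hlt
  · intro hs
    exact le_csSup hb hs

theorem hasSumRules_sr {a : ℤ → ℂ} {M : ℕ} (hM : 2 ≤ M) (h : (Function.support a).Finite)
    (h0 : a ≠ 0) : HasSumRules a M (sr a M) :=
  Nat.sSup_mem ⟨0, show HasSumRules a M 0 from ⟨a, h, fun z _ => by simp⟩⟩
    (bddAbove_sumRules hM h h0)

/-- With the support radius measured in units of L, only 2N + 1 values of v around q contribute,
whatever L is. This uniformity matters when L is a power M^n. -/
theorem tsum_conv_eq {L : ℕ} (hL : 0 < L) {a : ℤ → ℂ} {N : ℕ} (h : SuppIn (N * L) a)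
    (v : ℤ → ℂ) (q : ℤ) {g : ℤ} (hg0 : 0 ≤ g) (hg : g < L) :
    ∑' i : ℤ, v i * a ((L : ℤ) * q + g - L * i) =
      ∑ i ∈ Finset.Icc (-(N : ℤ)) N, v (q - i) * a ((L : ℤ) * i + g) := by
  rw [← (Equiv.subLeft q).tsum_eq, tsum_eq_sum (s := Finset.Icc (-(N : ℤ)) N)]
  · refine Finset.sum_congr rfl fun i _ => ?_
    simp only [Equiv.subLeft_apply]
    congr 2; ring
  · intro i hi
    simp only [Equiv.subLeft_apply]
    rw [h, mul_zero]
    rw [Finset.mem_Icc, not_and_or, not_le, not_le] at hi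
    have hL' : (0 : ℤ) < L := by exact_mod_cast hL
    push_cast
    rw [lt_abs]
    rcases hi with hi | hi
    · right; nlinarith
    · left; nlinarith

theorem SuppIn.mul_right {N : ℕ} {a : ℤ → ℂ} (h : SuppIn N a) {M : ℕ} (hM : 0 < M) :
    SuppIn (N * M) a := h.mono (Nat.le_mul_of_pos_right N hM)

theorem suppIn_subdiv (M : ℕ) {a v : ℤ → ℂ} {N R : ℕ} (ha : SuppIn N a) (hv : SuppIn R v) :
    SuppIn (M * R + N) (subdiv M a v) := by
  intro k hk
  have : ∀ i : ℤ, v i * a (k - M * i) = 0 := by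
    intro i
    by_cases hi : (R : ℤ) < |i|
    · rw [hv i hi, zero_mul]
    · rw [ha, mul_zero]
      rw [not_lt] at hi
      have h1 : |(M : ℤ) * i| ≤ M * R := by
        rw [abs_mul, Nat.abs_cast]
        exact mul_le_mul_of_nonneg_left hi (by positivity)
      have h2 := abs_sub_abs_le_abs_sub k (M * i)
      push_cast at hk
      linarith
  simp [subdiv, this]

theorem finite_support_dirac : (Function.support dirac).Finite := by
  refine (Set.finite_singleton (0 : ℤ)).subset fun k hk => ?_
  by_contra h
  exact hk (if_neg h)

/-! ### Data of the cyclic scheme and the composite mask -/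

section scheme

variable {r : ℕ} [NeZero r] {M : ℕ} {a : Fin r → ℤ → ℂ}

theorem exists_suppIn_family {ι : Type*} [Finite ι] {a : ι → ℤ → ℂ}
    (h : ∀ l, (Function.support (a l)).Finite) : ∃ N, ∀ l, SuppIn N (a l) := by
  choose N hN using fun l => exists_suppIn (h l)
  obtain ⟨B, hB⟩ := (Set.finite_range N).bddAbove
  exact ⟨B, fun l => (hN l).mono (hB ⟨l, rfl⟩)⟩

theorem suppIn_qsData_dirac (hM : 2 ≤ M) {N : ℕ} (h : ∀ l, SuppIn N (a l)) (n : ℕ) :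
    SuppIn (N * M ^ n) (qsData M a dirac n) := by
  -- The radius N M^n does not survive induction. The smaller one does: M N (M^n - 1) + N ≤ N
  -- (M^(n+1) - 1) because M ≥ 2.
  have key : SuppIn (N * (M ^ n - 1)) (qsData M a dirac n) := by
    induction n with
    | zero =>
      intro k hk
      simp only [qsData, dirac]
      rw [if_neg]
      rintro rfl
      simp at hk
    | succ n ih =>
      refine (suppIn_subdiv M (h _) ih).mono ?_
      obtain ⟨y, hy⟩ := Nat.exists_eq_succ_of_ne_zero (pow_ne_zero n (by omega : M ≠ 0))
      obtain ⟨M', rfl⟩ := Nat.exists_eq_add_of_le hM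
      rw [pow_succ, hy, Nat.succ_sub_one]
      have : (y.succ * (2 + M') - 1) = y * (2 + M') + 1 + M' := by
        rw [Nat.succ_mul]; omega
      rw [this]
      nlinarith [Nat.zero_le (N * M')]
  exact key.mono (Nat.mul_le_mul_left _ (Nat.sub_le _ _))

theorem finite_support_qsData (ha : ∀ l, (Function.support (a l)).Finite) {v : ℤ → ℂ}
    (hv : (Function.support v).Finite) (n : ℕ) : (Function.support (qsData M a v n)).Finite := by
  induction n with
  | zero => exact hv
  | succ n ih =>
    obtain ⟨N, hN⟩ := exists_suppIn (ha (Fin.ofNat r n))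
    obtain ⟨R, hR⟩ := exists_suppIn ih
    exact (suppIn_subdiv M hN hR).finite

theorem symbol_subdiv (M : ℕ) {a v : ℤ → ℂ} (ha : (Function.support a).Finite)
    (hv : (Function.support v).Finite) {z : ℂ} (hz : z ≠ 0) :
    symbol (subdiv M a v) z = M * symbol a z * symbol v (z ^ M) := by
  have h1 : ∀ j : ℤ, subdiv M a v j * z ^ j =
      ∑ k ∈ hv.toFinset, (M * v k) * (a (j - M * k) * z ^ j) := by
    intro j
    rw [subdiv, tsum_eq_sum (s := hv.toFinset), mul_assoc, Finset.sum_mul, Finset.mul_sum]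
    · exact Finset.sum_congr rfl fun k _ => by ring
    · intro k hk
      have : v k = 0 := by simpa using hk
      rw [this, zero_mul]
  have h2 : ∀ k : ℤ, ∑' j : ℤ, a (j - M * k) * z ^ j = (z ^ M) ^ k * symbol a z := by
    intro k
    have := symbol_shift a (M * k) hz
    rw [symbol] at this
    rw [this, zpow_mul, zpow_natCast]
  have h3 : symbol v (z ^ M) = ∑ k ∈ hv.toFinset, v k * (z ^ M) ^ k := by
    refine tsum_eq_sum fun k hk => ?_
    have : v k = 0 := by simpa using hk
    rw [this, zero_mul]
  rw [symbol, tsum_congr h1, Summable.tsum_finsetSum, h3, Finset.mul_sum]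
  · refine Finset.sum_congr rfl fun k _ => ?_
    rw [tsum_mul_left, h2]
    ring
  · intro k _
    exact (summable_symbol (finite_support_shift ha (M * k)) z).mul_left _

theorem symbol_one (a : ℤ → ℂ) : symbol a 1 = ∑' k, a k := by simp [symbol]

theorem symbol_dirac (z : ℂ) : symbol dirac z = 1 := by
  rw [symbol, tsum_eq_single 0]
  · simp [dirac]
  · intro k hk; simp [dirac, hk]

theorem tsum_qsData_dirac (ha : ∀ l, (Function.support (a l)).Finite)
    (hsum : ∀ l, ∑' k : ℤ, a l k = 1) (n : ℕ) :
    ∑' k, qsData M a dirac n k = (M : ℂ) ^ n := by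
  rw [← symbol_one]
  induction n with
  | zero => rw [pow_zero]; exact symbol_dirac 1
  | succ n ih =>
    rw [qsData, symbol_subdiv M (ha _) (finite_support_qsData ha finite_support_dirac n)
      one_ne_zero, one_pow, ih, symbol_one, hsum]
    ring

/-- Linearity and shift covariance reduce arbitrary, possibly unbounded, initial data to the data of
δ. The interchange of sums is harmless because at each point only finitely many mask values are
nonzero. -/
theorem qsData_eq_tsum (hM : 0 < M) (ha : ∀ l, (Function.support (a l)).Finite) (v : ℤ → ℂ)
    (n : ℕ) (k : ℤ) :
    qsData M a v n k = ∑' i : ℤ, v i * qsData M a dirac n (k - (M : ℤ) ^ n * i) := by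
  induction n generalizing k with
  | zero =>
    rw [tsum_eq_single k]
    · simp [qsData, dirac]
    · intro i hi
      have : k - i ≠ 0 := sub_ne_zero.mpr hi.symm
      simp [qsData, dirac, this]
  | succ n ih =>
    set A := a (Fin.ofNat r n) with hA
    set d := qsData M a dirac n with hd
    have hdf : (Function.support d).Finite := finite_support_qsData ha finite_support_dirac n
    have hs : (Function.support fun j : ℤ => A (k - M * j)).Finite := by
      refine (ha (Fin.ofNat r n)).preimage (f := fun j : ℤ => k - M * j) (Function.Injective.injOn ?_)
      intro x y hxy
      have : (M : ℤ) * x = M * y := by simpa using hxy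
      exact mul_left_cancel₀ (by exact_mod_cast hM.ne') this
    have hz : ∀ j ∉ hs.toFinset, A (k - M * j) = 0 := fun j hj => by simpa using hj
    have hMn : 0 < M ^ n := pow_pos hM n
    calc qsData M a v (n + 1) k
        = M * ∑' j : ℤ, qsData M a v n j * A (k - M * j) := rfl
      _ = M * ∑ j ∈ hs.toFinset, ∑' i : ℤ, v i * d (j - (M : ℤ) ^ n * i) * A (k - M * j) := by
          rw [tsum_eq_sum (s := hs.toFinset) fun j hj => by rw [hz j hj, mul_zero]]
          congr 1
          exact Finset.sum_congr rfl fun j _ => by rw [ih, tsum_mul_right]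
      _ = M * ∑' i : ℤ, ∑ j ∈ hs.toFinset, v i * d (j - (M : ℤ) ^ n * i) * A (k - M * j) := by
          rw [Summable.tsum_finsetSum]
          intro j _
          have := summable_subdiv hMn hdf v j
          push_cast at this
          exact this.mul_right _
      _ = ∑' i : ℤ, v i * (M * ∑ j ∈ hs.toFinset, d (j - (M : ℤ) ^ n * i) * A (k - M * j)) := by
          rw [← tsum_mul_left]
          refine tsum_congr fun i => ?_
          rw [Finset.mul_sum, Finset.mul_sum, Finset.mul_sum]
          exact Finset.sum_congr rfl fun j _ => by ring
      _ = ∑' i : ℤ, v i * qsData M a dirac (n + 1) (k - (M : ℤ) ^ (n + 1) * i) := by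
          refine tsum_congr fun i => ?_
          congr 1
          rw [← tsum_eq_sum (L := .unconditional ℤ)
            (f := fun j => d (j - (M : ℤ) ^ n * i) * A (k - M * j))
            fun j hj => by rw [hz j hj, mul_zero]]
          change _ = M * ∑' j : ℤ, d j * A (k - (M : ℤ) ^ (n + 1) * i - M * j)
          congr 1
          rw [← (Equiv.addRight ((M : ℤ) ^ n * i)).tsum_eq]
          refine tsum_congr fun j => ?_
          simp only [Equiv.coe_addRight, add_sub_cancel_right]
          congr 2; ring

theorem qsData_period (v : ℤ → ℂ) (q s : ℕ) :
    qsData M a v (r * q + s) = qsData M a (qsData M a v (r * q)) s := by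
  induction s with
  | zero => rfl
  | succ s ih =>
    rw [← add_assoc, qsData, qsData, ih]
    congr 2
    ext
    simp

theorem compositeMask_apply (hM : 0 < M) (k : ℤ) :
    ((M ^ r : ℕ) : ℂ) * compositeMask M a k = qsData M a dirac r k := by
  rw [compositeMask, Nat.cast_pow, mul_inv_cancel_left₀]
  exact pow_ne_zero _ (by exact_mod_cast hM.ne')

theorem subdiv_compositeMask (hM : 0 < M) (ha : ∀ l, (Function.support (a l)).Finite)
    (v : ℤ → ℂ) : subdiv (M ^ r) (compositeMask M a) v = qsData M a v r := by
  funext k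
  rw [subdiv, ← tsum_mul_left, qsData_eq_tsum hM ha]
  refine tsum_congr fun i => ?_
  rw [← mul_assoc, mul_comm _ (v i), mul_assoc, compositeMask_apply hM]
  push_cast
  rfl

theorem subdiv_compositeMask_iterate (hM : 0 < M) (ha : ∀ l, (Function.support (a l)).Finite)
    (v : ℤ → ℂ) (q : ℕ) :
    (subdiv (M ^ r) (compositeMask M a))^[q] v = qsData M a v (r * q) := by
  induction q with
  | zero => rfl
  | succ q ih =>
    rw [Function.iterate_succ_apply', ih, subdiv_compositeMask hM ha, mul_add, mul_one,
      qsData_period]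

theorem qsData_fin_one (L : ℕ) (A v : ℤ → ℂ) (n : ℕ) :
    qsData L (fun _ : Fin 1 => A) v n = (subdiv L A)^[n] v := by
  induction n with
  | zero => rfl
  | succ n ih => rw [Function.iterate_succ_apply', qsData, ih]

theorem backDiff_iterate_qsData_box (hM : 0 < M) {c : Fin r → ℤ → ℂ}
    (hc : ∀ l, (Function.support (c l)).Finite) (J : ℕ) (v : ℤ → ℂ) (n : ℕ) :
    backDiff^[J] (qsData M (fun l => (box M)^[J] (c l)) v n) = qsData M c (backDiff^[J] v) n := by
  induction n with
  | zero => rfl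
  | succ n ih => rw [qsData, qsData, backDiff_iterate_subdiv_box hM (hc _), ih]

theorem qsData_shiftDiff (hM : 0 < M) (ha : ∀ l, (Function.support (a l)).Finite) (v : ℤ → ℂ)
    (s : ℤ) (n : ℕ) :
    qsData M a (shiftDiff s v) n = shiftDiff ((M : ℤ) ^ n * s) (qsData M a v n) := by
  induction n with
  | zero => simp [qsData]
  | succ n ih =>
    rw [qsData, qsData, ih, subdiv_shiftDiff hM (ha _)]
    congr 1; ring

theorem qsData_backDiff_iterate (hM : 0 < M) (ha : ∀ l, (Function.support (a l)).Finite)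
    (v : ℤ → ℂ) (J n : ℕ) :
    qsData M a (backDiff^[J] v) n = (shiftDiff ((M ^ n : ℕ) : ℤ))^[J] (qsData M a v n) := by
  induction J with
  | zero => rfl
  | succ J ih =>
    rw [Function.iterate_succ_apply', Function.iterate_succ_apply', ← ih, backDiff_eq_shiftDiff,
      qsData_shiftDiff hM ha]
    push_cast
    rw [mul_one]

theorem finite_support_compositeMask (ha : ∀ l, (Function.support (a l)).Finite) :
    (Function.support (compositeMask M a)).Finite :=
  (finite_support_qsData ha finite_support_dirac r (M := M)).subset
    fun k hk hk' => hk (by simp [compositeMask, hk'])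

theorem tsum_compositeMask (hM : 0 < M) (ha : ∀ l, (Function.support (a l)).Finite)
    (hsum : ∀ l, ∑' k : ℤ, a l k = 1) : ∑' k, compositeMask M a k = 1 := by
  unfold compositeMask
  rw [tsum_mul_left, tsum_qsData_dirac ha hsum, inv_mul_cancel₀]
  exact pow_ne_zero _ (by exact_mod_cast hM.ne')

/-- ∇^J of the r-step data equals the quotient data started from ∇^J δ. These are J-fold step-M^r
differences, that is ∇^J of a J-fold box of width M^r; ∇^J then cancels on finitely supported
sequences. -/
theorem hasSumRules_compositeMask (hM : 0 < M) (ha : ∀ l, (Function.support (a l)).Finite)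
    {J : ℕ} (h : ∀ l, HasSumRules (a l) M J) : HasSumRules (compositeMask M a) (M ^ r) J := by
  choose c hc hac using fun l => (hasSumRules_iff (ha l) M J).mp (h l)
  have hd := finite_support_qsData hc finite_support_dirac r (M := M)
  have hq : qsData M a dirac r = (box (M ^ r))^[J] (qsData M c dirac r) := by
    refine backDiff_iterate_injective (finite_support_qsData ha finite_support_dirac r)
      (finite_support_box_iterate hd _ _) J ?_
    rw [backDiff_iterate_box_iterate, ← qsData_backDiff_iterate hM hc,
      ← backDiff_iterate_qsData_box hM hc]
    rw [show a = fun l => (box M)^[J] (c l) from funext hac]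
  have hd' : (Function.support (fun k => ((M : ℂ) ^ r)⁻¹ * qsData M c dirac r k)).Finite :=
    hd.subset fun k hk hk' => hk (by simp [hk'])
  refine ⟨_, hd', fun z hz => ?_⟩
  have h1 : ∀ f : ℤ → ℂ, symbol (fun k => ((M : ℂ) ^ r)⁻¹ * f k) z =
      ((M : ℂ) ^ r)⁻¹ * symbol f z := by
    intro f
    simp only [symbol, mul_assoc, tsum_mul_left]
  rw [h1, show compositeMask M a = fun k => ((M : ℂ) ^ r)⁻¹ * qsData M a dirac r k from rfl, h1, hq,
    symbol_box_iterate hd _ _ hz]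
  ring

end scheme

/-! ### Sup-norm estimates and coset sums -/

theorem int_eq_mul_add {L : ℕ} (hL : 0 < L) (j : ℤ) :
    ∃ q g : ℤ, 0 ≤ g ∧ g < L ∧ j = (L : ℤ) * q + g := by
  have hL' : (0 : ℤ) < L := by exact_mod_cast hL
  exact ⟨j / L, j % L, Int.emod_nonneg _ hL'.ne', Int.emod_lt_of_pos _ hL',
    (Int.mul_ediv_add_emod j L).symm⟩

theorem SuppIn.exists_bound {N : ℕ} {a : ℤ → ℂ} (h : SuppIn N a) :
    ∃ B : ℝ, 0 ≤ B ∧ ∀ k, ‖a k‖ ≤ B := by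
  refine ⟨∑ k ∈ Finset.Icc (-(N : ℤ)) N, ‖a k‖, Finset.sum_nonneg fun _ _ => norm_nonneg _,
    fun k => ?_⟩
  by_cases hk : (N : ℤ) < |k|
  · rw [h k hk, norm_zero]
    exact Finset.sum_nonneg fun _ _ => norm_nonneg _
  · rw [not_lt, abs_le] at hk
    exact Finset.single_le_sum (f := fun k => ‖a k‖) (fun _ _ => norm_nonneg _)
      (Finset.mem_Icc.mpr hk)

theorem card_Icc_neg (N : ℕ) : ((Finset.Icc (-(N : ℤ)) N).card : ℝ) = 2 * N + 1 := by
  rw [Int.card_Icc]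
  have : ((N : ℤ) + 1 - -N).toNat = 2 * N + 1 := by omega
  rw [this]; push_cast; ring

theorem norm_tsum_conv_le {L : ℕ} (hL : 0 < L) {a v : ℤ → ℂ} {N : ℕ} (h : SuppIn (N * L) a)
    {B E : ℝ} (hB : ∀ k, ‖a k‖ ≤ B) (hE : ∀ k, ‖v k‖ ≤ E) (j : ℤ) :
    ‖∑' i : ℤ, v i * a (j - L * i)‖ ≤ (2 * N + 1) * (E * B) := by
  obtain ⟨q, g, hg0, hg, rfl⟩ := int_eq_mul_add hL j
  rw [tsum_conv_eq hL h v q hg0 hg]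
  refine (norm_sum_le_of_le _ (fun i _ => ?_)).trans_eq
    (by rw [Finset.sum_const, nsmul_eq_mul, card_Icc_neg])
  rw [norm_mul]
  exact mul_le_mul (hE _) (hB _) (norm_nonneg _) ((norm_nonneg _).trans (hE 0))

theorem exists_norm_subdiv_le {M : ℕ} (hM : 0 < M) {a : ℤ → ℂ}
    (ha : (Function.support a).Finite) :
    ∃ K : ℝ, 0 ≤ K ∧ ∀ (v : ℤ → ℂ) (E : ℝ), (∀ k, ‖v k‖ ≤ E) →
      ∀ j, ‖subdiv M a v j‖ ≤ K * E := by
  obtain ⟨N, hN⟩ := exists_suppIn ha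
  obtain ⟨B, hB0, hB⟩ := hN.exists_bound
  refine ⟨M * ((2 * N + 1) * B), by positivity, fun v E hE j => ?_⟩
  rw [subdiv, norm_mul, Complex.norm_natCast]
  have := norm_tsum_conv_le hM (hN.mul_right hM) hB hE j
  calc (M : ℝ) * _ ≤ M * ((2 * N + 1) * (E * B)) := by gcongr
    _ = _ := by ring

/-- Telescoping to the left in steps of L leaves the support after 2N + 1 steps, so the constant
does not depend on L. -/
theorem norm_le_of_shiftDiff_le {L : ℕ} (hL : 0 < L) {u : ℤ → ℂ} {N : ℕ}
    (hu : SuppIn (N * L) u) {E : ℝ} (hE : ∀ k, ‖shiftDiff L u k‖ ≤ E) (k : ℤ) :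
    ‖u k‖ ≤ (2 * N + 1) * E := by
  have hE0 : 0 ≤ E := (norm_nonneg _).trans (hE 0)
  by_cases hk : ((N * L : ℕ) : ℤ) < |k|
  · rw [hu k hk, norm_zero]; positivity
  have key : ∀ n : ℕ, ‖u k‖ ≤ n * E + ‖u (k - n * L)‖ := by
    intro n
    induction n with
    | zero => simp
    | succ n ih =>
      have h1 : u (k - n * L) = shiftDiff L u (k - n * L) + u (k - (n + 1 : ℕ) * L) := by
        simp only [shiftDiff]
        rw [show k - ((n + 1 : ℕ) : ℤ) * L = k - n * L - L by push_cast; ring]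
        ring
      have h2 := norm_add_le (shiftDiff L u (k - n * L)) (u (k - (n + 1 : ℕ) * L))
      rw [← h1] at h2
      have := hE (k - n * L)
      push_cast at *
      linarith
  have h := key (2 * N + 1)
  rw [hu (k - _), norm_zero, add_zero] at h
  · push_cast at h; exact h
  · rw [not_lt, abs_le] at hk
    have hL' : (0 : ℤ) < L := by exact_mod_cast hL
    rw [lt_abs]; right
    push_cast at *
    nlinarith

theorem SuppIn.shiftDiff {L N : ℕ} {u : ℤ → ℂ} (hu : SuppIn (N * L) u) :
    SuppIn ((N + 1) * L) (shiftDiff L u) := by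
  intro k hk
  have h2 := abs_sub_abs_le_abs_sub k (L : ℤ)
  rw [Nat.abs_cast] at h2
  push_cast at hk
  have h0 : (0 : ℤ) ≤ L := by positivity
  simp only [Subdivision.shiftDiff]
  rw [hu k (by push_cast; linarith), hu (k - L) (by push_cast; linarith), sub_zero]

/-- Each difference of step L enlarges the support radius by one unit of L; hence N + J in the
constant. -/
theorem norm_le_of_shiftDiff_iterate_le {L : ℕ} (hL : 0 < L) (J : ℕ) {u : ℤ → ℂ} {N : ℕ}
    (hu : SuppIn (N * L) u) {E : ℝ} (hE : ∀ k, ‖(Subdivision.shiftDiff L)^[J] u k‖ ≤ E) (k : ℤ) :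
    ‖u k‖ ≤ (2 * (N + J) + 1) ^ J * E := by
  have hE0 : 0 ≤ E := (norm_nonneg _).trans (hE 0)
  induction J generalizing u N k with
  | zero => simpa using hE k
  | succ J ih =>
    have h1 := norm_le_of_shiftDiff_le hL hu (fun k => ih hu.shiftDiff hE k) k
    refine h1.trans ?_
    rw [pow_succ', mul_assoc]
    push_cast
    rw [show ((N : ℝ) + 1 + J) = N + (J + 1) by ring]
    gcongr
    linarith

theorem norm_sub_le_of_backDiff_le {w : ℤ → ℂ} {E : ℝ} (hE : ∀ k, ‖backDiff w k‖ ≤ E)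
    (x y : ℤ) : ‖w x - w y‖ ≤ |((x - y : ℤ) : ℝ)| * E := by
  have key : ∀ (n : ℕ) (k : ℤ), ‖w (k + n) - w k‖ ≤ n * E := by
    intro n k
    induction n with
    | zero => simp
    | succ n ih =>
      have h := hE (k + (n + 1 : ℕ))
      simp only [backDiff] at h
      rw [show k + ((n + 1 : ℕ) : ℤ) - 1 = k + n by push_cast; ring] at h
      have := norm_add_le (w (k + (n + 1 : ℕ)) - w (k + n)) (w (k + n) - w k)
      rw [sub_add_sub_cancel] at this
      push_cast at *
      linarith
  rcases le_total y x with h | h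
  · obtain ⟨n, hn⟩ := Int.eq_ofNat_of_zero_le (sub_nonneg.mpr h)
    have := key n y
    rw [← hn, add_sub_cancel] at this
    rw [hn]; simpa using this
  · obtain ⟨n, hn⟩ := Int.eq_ofNat_of_zero_le (sub_nonneg.mpr h)
    have := key n x
    rw [← hn, add_sub_cancel, norm_sub_rev] at this
    rw [← neg_sub y x, hn]; simpa using this

/-- The length-M windows summed by the box, placed at steps of M, tile ℤ. -/
theorem tsum_coset_box {M : ℕ} (hM : 0 < M) {c : ℤ → ℂ} (hc : (Function.support c).Finite)
    (k : ℤ) : ∑' i : ℤ, box M c (k - M * i) = ∑' i, c i := by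
  have : NeZero M := ⟨hM.ne'⟩
  rw [← (Equiv.subLeft k).tsum_eq c,
    ← (Int.divModEquiv M).symm.tsum_eq (fun i => c (Equiv.subLeft k i))]
  have hinj : Function.Injective fun p => Equiv.subLeft k ((Int.divModEquiv M).symm p) :=
    (Equiv.subLeft k).injective.comp (Int.divModEquiv M).symm.injective
  have hs : Summable fun p : ℤ × Fin M => c (Equiv.subLeft k ((Int.divModEquiv M).symm p)) :=
    summable_of_hasFiniteSupport (hc.preimage hinj.injOn)
  rw [hs.tsum_prod]
  refine tsum_congr fun i => ?_
  rw [tsum_fintype, box, Finset.sum_range]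
  refine Finset.sum_congr rfl fun t _ => ?_
  simp only [Int.divModEquiv, Equiv.subLeft_apply]
  congr 1
  simp
  ring

theorem tsum_box_iterate {M : ℕ} {c : ℤ → ℂ} (hc : (Function.support c).Finite)
    (J : ℕ) : ∑' k, (box M)^[J] c k = (M : ℂ) ^ J * ∑' k, c k := by
  rw [← symbol_one, symbol_box_iterate hc M J one_ne_zero, symbol_one]
  simp

/-- Converse of `tsum_coset_box`, by explicit division: the quotient sums ∇b over k, k - M, k - 2M,
and so on. To the right of the support this is a full coset sum of ∇b, which is zero because the
coset sums of b agree; so the quotient is finitely supported. -/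
theorem exists_box_of_tsum_coset {M : ℕ} (hM : 0 < M) {b : ℤ → ℂ}
    (hb : (Function.support b).Finite) {κ : ℂ}
    (h : ∀ k : ℤ, ∑' i : ℤ, b (k - M * i) = κ) :
    ∃ c : ℤ → ℂ, (Function.support c).Finite ∧ b = box M c := by
  have hM' : (0 : ℤ) < M := by exact_mod_cast hM
  have hf := finite_support_shiftDiff hb 1
  obtain ⟨N, hN⟩ := exists_suppIn hf
  have hinj : ∀ k : ℤ, Function.Injective fun i : ℤ => k - (M : ℤ) * i := by
    intro k x y hxy
    have : (M : ℤ) * x = M * y := by simpa using hxy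
    exact mul_left_cancel₀ hM'.ne' this
  have hs : ∀ (f : ℤ → ℂ), (Function.support f).Finite → ∀ k : ℤ,
      Summable fun i : ℤ => f (k - M * i) := fun f hf k =>
    summable_of_hasFiniteSupport (hf.preimage (hinj k).injOn)
  have hT : ∀ k : ℤ, ∑' i : ℤ, shiftDiff 1 b (k - M * i) = 0 := by
    intro k
    simp only [shiftDiff]
    rw [(hs b hb k).tsum_sub, h]
    · have := h (k - 1)
      simp only [sub_right_comm k 1] at this
      rw [this, sub_self]
    · refine (hs b hb (k - 1)).congr fun i => ?_
      rw [sub_right_comm]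
  set c : ℤ → ℂ := fun k => ∑' i : ℕ, shiftDiff 1 b (k - M * i) with hcdef
  have hsN : ∀ k : ℤ, Summable fun i : ℕ => shiftDiff 1 b (k - M * i) := fun k =>
    (hs _ hf k).comp_injective Nat.cast_injective
  have hcsupp : SuppIn N c := by
    intro k hk
    rw [lt_abs] at hk
    rcases hk with hk | hk
    · rw [← hT k]
      refine (Nat.cast_injective (R := ℤ)).tsum_eq
        (f := fun i : ℤ => shiftDiff 1 b (k - M * i)) fun i hi => ?_
      rcases le_or_gt 0 i with h0 | h0
      · exact ⟨i.toNat, by simp [h0]⟩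
      · refine absurd (hN _ ?_) hi
        rw [lt_abs]; left
        nlinarith
    · refine (tsum_congr fun i => hN _ ?_).trans tsum_zero
      rw [lt_abs]; right
      have : (0 : ℤ) ≤ M * i := by positivity
      linarith
  refine ⟨c, hcsupp.finite, ?_⟩
  refine backDiff_iterate_injective hb (finite_support_box hcsupp.finite M) 1 ?_
  rw [Function.iterate_one, shiftDiff_box]
  funext k
  change shiftDiff 1 b k = c k - c (k - M)
  have h0 := (hsN k).tsum_eq_zero_add
  have h1 : c (k - M) = ∑' i : ℕ, shiftDiff 1 b (k - M * ((i + 1 : ℕ) : ℤ)) := by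
    refine tsum_congr fun i => ?_
    congr 1; push_cast; ring
  rw [h1, hcdef]
  simp only
  rw [h0]
  simp

/-- After removing j box factors one remains, so M^(j+1) times the quotient sums to 1 over every
coset. The difference is then a combination of values w(q - i) - w(q), |i| ≤ N, of w = ∇^j v, each
controlled by ∇w. -/
theorem exists_norm_backDiff_subdiv_sub_le {M : ℕ} (hM : 0 < M) {a : ℤ → ℂ}
    (ha : (Function.support a).Finite) (hsum : ∑' k : ℤ, a k = 1) {j : ℕ}
    (hs : HasSumRules a M (j + 1)) :
    ∃ C : ℝ, 0 ≤ C ∧ ∀ (v : ℤ → ℂ) (E : ℝ), (∀ k, ‖backDiff^[j + 1] v k‖ ≤ E) →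
      ∀ q g : ℤ, 0 ≤ g → g < M →
        ‖(M : ℂ) ^ j * backDiff^[j] (subdiv M a v) (M * q + g) - backDiff^[j] v q‖ ≤ C * E := by
  obtain ⟨c, hc, hac⟩ := (hasSumRules_iff ha M (j + 1)).mp hs
  have hb := finite_support_box hc M
  obtain ⟨N, hN⟩ := exists_suppIn hb
  obtain ⟨B, hB0, hB⟩ := hN.exists_bound
  have hκ : (M : ℂ) ^ (j + 1) * ∑' k, c k = 1 := by rw [← hsum, hac, tsum_box_iterate hc]
  refine ⟨M ^ (j + 1) * ((2 * N + 1) * (N * B)), by positivity, fun v E hE q g hg0 hg => ?_⟩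
  have hE0 : 0 ≤ E := (norm_nonneg _).trans (hE 0)
  rw [Function.iterate_succ_apply] at hac
  rw [hac, backDiff_iterate_subdiv_box hM hb]
  set w := backDiff^[j] v with hw
  rw [Function.iterate_succ', Function.comp_def] at hE
  have h1 := tsum_conv_eq hM (hN.mul_right hM) (fun _ => 1) q hg0 hg
  simp only [one_mul] at h1
  rw [tsum_coset_box hM hc] at h1
  have h2 : (M : ℂ) ^ j * subdiv M (box M c) w (M * q + g) - w q =
      (M : ℂ) ^ (j + 1) * ∑ i ∈ Finset.Icc (-(N : ℤ)) N,
        (w (q - i) - w q) * box M c (M * i + g) := by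
    simp only [sub_mul, Finset.sum_sub_distrib]
    rw [← Finset.mul_sum, ← h1, subdiv, tsum_conv_eq hM (hN.mul_right hM) w q hg0 hg]
    linear_combination (w q) * hκ
  rw [h2, norm_mul, norm_pow, Complex.norm_natCast, mul_assoc]
  refine mul_le_mul_of_nonneg_left ?_ (by positivity)
  refine (norm_sum_le_of_le _ (f := fun i => (w (q - i) - w q) * box M c (M * i + g))
    (n := fun _ => N * E * B) (fun i hi => ?_)).trans_eq
    (by rw [Finset.sum_const, nsmul_eq_mul, card_Icc_neg]; ring)
  rw [norm_mul]
  refine mul_le_mul ?_ (hB _) (norm_nonneg _) (by positivity)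
  refine (norm_sub_le_of_backDiff_le hE _ _).trans (mul_le_mul_of_nonneg_right ?_ hE0)
  rw [sub_sub_cancel_left]
  rw [Finset.mem_Icc, ← abs_le] at hi
  push_cast
  rw [abs_neg]
  exact_mod_cast hi

section scheme

variable {r : ℕ} [NeZero r] {M : ℕ} {a : Fin r → ℤ → ℂ}

theorem exists_uniform_bound {ι : Type*} [Finite ι] {P : ι → ℝ → Prop}
    (hmono : ∀ i C C', C ≤ C' → P i C → P i C') (h : ∀ i, ∃ C, 0 ≤ C ∧ P i C) :
    ∃ C, 0 ≤ C ∧ ∀ i, P i C := by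
  choose C hC0 hC using h
  obtain ⟨B, hB⟩ := (Set.finite_range C).bddAbove
  exact ⟨max B 0, le_max_right _ _,
    fun i => hmono i _ _ ((hB ⟨i, rfl⟩).trans (le_max_left _ _)) (hC i)⟩

theorem exists_norm_backDiff_qsData_sub_le (hM : 0 < M)
    (ha : ∀ l, (Function.support (a l)).Finite) (hsum : ∀ l, ∑' k : ℤ, a l k = 1) {j : ℕ}
    (hs : ∀ l, HasSumRules (a l) M (j + 1)) :
    ∃ C : ℝ, 0 ≤ C ∧ ∀ (v : ℤ → ℂ) (n : ℕ) (E : ℝ),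
      (∀ k, ‖backDiff^[j + 1] (qsData M a v n) k‖ ≤ E) → ∀ q g : ℤ, 0 ≤ g → g < M →
        ‖(M : ℂ) ^ j * backDiff^[j] (qsData M a v (n + 1)) (M * q + g)
          - backDiff^[j] (qsData M a v n) q‖ ≤ C * E := by
  obtain ⟨C, hC0, hC⟩ := exists_uniform_bound
    (P := fun l C => ∀ (v : ℤ → ℂ) (E : ℝ), (∀ k, ‖backDiff^[j + 1] v k‖ ≤ E) →
      ∀ q g : ℤ, 0 ≤ g → g < M →
        ‖(M : ℂ) ^ j * backDiff^[j] (subdiv M (a l) v) (M * q + g) - backDiff^[j] v q‖ ≤ C * E)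
    (fun l C C' hCC h v E hE q g hg0 hg => (h v E hE q g hg0 hg).trans
      (mul_le_mul_of_nonneg_right hCC ((norm_nonneg _).trans (hE 0))))
    (fun l => exists_norm_backDiff_subdiv_sub_le hM (ha l) (hsum l) (hs l))
  exact ⟨C, hC0, fun v n E hE q g hg0 hg => hC _ _ E hE q g hg0 hg⟩

/-- The sup norms x_n of the j-th differences satisfy x_{n+1} ≤ M^(-j) (x_n + C ρ^n), and the
forcing term dominates since ρ > M^(-j). -/
theorem decay_backDiff_of_decay_succ (hM : 0 < M) (ha : ∀ l, (Function.support (a l)).Finite)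
    (hsum : ∀ l, ∑' k : ℤ, a l k = 1) {j : ℕ} (hs : ∀ l, HasSumRules (a l) M (j + 1))
    {v : ℤ → ℂ} (hv : ∃ C₀, ∀ k, ‖backDiff^[j] v k‖ ≤ C₀) {ρ : ℝ} (hρ : ((M : ℝ) ^ j)⁻¹ < ρ)
    (h : ∃ C, ∀ n k, ‖backDiff^[j + 1] (qsData M a v n) k‖ ≤ C * ρ ^ n) :
    ∃ C, ∀ n k, ‖backDiff^[j] (qsData M a v n) k‖ ≤ C * ρ ^ n := by
  obtain ⟨C₁, hC₁0, hC₁⟩ := exists_norm_backDiff_qsData_sub_le hM ha hsum hs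
  obtain ⟨C₀, hC₀⟩ := hv
  obtain ⟨C, hC⟩ := h
  have hMj : (0 : ℝ) < (M : ℝ) ^ j := pow_pos (by exact_mod_cast hM) j
  have hρ0 : 0 < ρ := (inv_pos.mpr hMj).trans hρ
  -- The second entry is the D solving M^(-j) (D + C₁ C) = D ρ, which makes the bound inductive.
  set D := max C₀ (((M : ℝ) ^ j)⁻¹ * (C₁ * C) / (ρ - ((M : ℝ) ^ j)⁻¹)) with hD
  have hD2 : ((M : ℝ) ^ j)⁻¹ * (D + C₁ * C) ≤ D * ρ := by
    have := le_max_right C₀ (((M : ℝ) ^ j)⁻¹ * (C₁ * C) / (ρ - ((M : ℝ) ^ j)⁻¹))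
    rw [← hD, div_le_iff₀ (sub_pos.mpr hρ)] at this
    linarith
  refine ⟨D, fun n => ?_⟩
  induction n with
  | zero =>
    intro k
    rw [pow_zero, mul_one]
    exact (hC₀ k).trans (le_max_left _ _)
  | succ n ih =>
    intro k
    obtain ⟨q, g, hg0, hg, rfl⟩ := int_eq_mul_add hM k
    have h1 := hC₁ v n _ (hC n) q g hg0 hg
    have h2 := ih q
    set x := backDiff^[j] (qsData M a v (n + 1)) (M * q + g)
    set y := backDiff^[j] (qsData M a v n) q
    have h3 : (M : ℝ) ^ j * ‖x‖ ≤ (D + C₁ * C) * ρ ^ n := by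
      have h4 : ‖(M : ℂ) ^ j * x‖ = (M : ℝ) ^ j * ‖x‖ := by
        rw [norm_mul, norm_pow, Complex.norm_natCast]
      rw [← h4]
      have := norm_add_le ((M : ℂ) ^ j * x - y) y
      rw [sub_add_cancel] at this
      linarith
    calc ‖x‖ = ((M : ℝ) ^ j)⁻¹ * ((M : ℝ) ^ j * ‖x‖) := by field_simp
      _ ≤ ((M : ℝ) ^ j)⁻¹ * ((D + C₁ * C) * ρ ^ n) := by gcongr
      _ = ((M : ℝ) ^ j)⁻¹ * (D + C₁ * C) * ρ ^ n := by ring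
      _ ≤ D * ρ * ρ ^ n := by gcongr
      _ = D * ρ ^ (n + 1) := by ring

end scheme

/-! ### The exponent of a stationary scheme as geometric decay -/

theorem supNorm_nonneg (v : ℤ → ℂ) : 0 ≤ supNorm v := Real.iSup_nonneg fun _ => norm_nonneg _

theorem supNorm_le {v : ℤ → ℂ} {E : ℝ} (h : ∀ k, ‖v k‖ ≤ E) : supNorm v ≤ E := ciSup_le h

theorem norm_le_supNorm {v : ℤ → ℂ} (h : (Function.support v).Finite) (k : ℤ) :
    ‖v k‖ ≤ supNorm v := by
  obtain ⟨N, hN⟩ := exists_suppIn h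
  obtain ⟨B, -, hB⟩ := hN.exists_bound
  exact le_ciSup (f := fun k => ‖v k‖) ⟨B, by rintro _ ⟨k, rfl⟩; exact hB k⟩ k

theorem norm_backDiff_iterate_le {v : ℤ → ℂ} {E : ℝ} (h : ∀ k, ‖v k‖ ≤ E) (J : ℕ) (k : ℤ) :
    ‖backDiff^[J] v k‖ ≤ 2 ^ J * E := by
  induction J generalizing k with
  | zero => simpa using h k
  | succ J ih =>
    rw [Function.iterate_succ_apply']
    refine (norm_sub_le _ _).trans ?_
    have := ih k
    have := ih (k - 1)
    rw [pow_succ]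
    linarith

theorem finite_support_backDiff_iterate {v : ℤ → ℂ} (h : (Function.support v).Finite) (J : ℕ) :
    (Function.support (backDiff^[J] v)).Finite :=
  finite_support_iterate (fun _ ha => finite_support_shiftDiff ha 1) h J

theorem rpow_one_div_le_iff {x y : ℝ} (hx : 0 ≤ x) (hy : 0 ≤ y) {n : ℕ} (hn : n ≠ 0) :
    x ^ (1 / (n : ℝ)) ≤ y ↔ x ≤ y ^ n := by
  have hn' : (0 : ℝ) < n := by exact_mod_cast Nat.pos_of_ne_zero hn
  rw [one_div, Real.rpow_inv_le_iff_of_pos hx hy hn', Real.rpow_natCast]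

theorem le_rpow_one_div_iff {x y : ℝ} (hx : 0 ≤ x) (hy : 0 ≤ y) {n : ℕ} (hn : n ≠ 0) :
    y ≤ x ^ (1 / (n : ℝ)) ↔ y ^ n ≤ x := by
  have hn' : (0 : ℝ) < n := by exact_mod_cast Nat.pos_of_ne_zero hn
  rw [one_div, Real.le_rpow_inv_iff_of_pos hy hx hn', Real.rpow_natCast]

theorem exists_bound_of_eventually {d : ℕ → ℝ} {ρ : ℝ} (hρ : 0 < ρ)
    (h : ∀ᶠ n in atTop, d n ≤ ρ ^ n) : ∃ C, ∀ n, d n ≤ C * ρ ^ n := by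
  obtain ⟨N, hN⟩ := eventually_atTop.mp h
  have h0 : ∀ i ∈ Finset.range N, 0 ≤ |d i| / ρ ^ i := fun i _ => by positivity
  refine ⟨1 + ∑ i ∈ Finset.range N, |d i| / ρ ^ i, fun n => ?_⟩
  rw [add_mul, one_mul]
  rcases lt_or_ge n N with hn | hn
  · have h1 := Finset.single_le_sum h0 (Finset.mem_range.mpr hn)
    have h2 : |d n| / ρ ^ n * ρ ^ n = |d n| := by field_simp
    have h3 := mul_le_mul_of_nonneg_right h1 (pow_pos hρ n).le
    have := le_abs_self (d n)
    have := pow_pos hρ n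
    linarith
  · have := mul_nonneg (Finset.sum_nonneg h0) (pow_pos hρ n).le
    linarith [hN n hn]

section stationary

variable {L : ℕ} {A : ℤ → ℂ}

theorem finite_support_subdiv_iterate (hA : (Function.support A).Finite) (n : ℕ) :
    (Function.support ((subdiv L A)^[n] dirac)).Finite := by
  rw [← qsData_fin_one]
  exact finite_support_qsData (fun _ => hA) finite_support_dirac n

theorem isBoundedUnder_roots (hL : 0 < L) (hA : (Function.support A).Finite) (J : ℕ) :
    IsBoundedUnder (· ≤ ·) atTop
      (fun n : ℕ => supNorm (backDiff^[J] ((subdiv L A)^[n] dirac)) ^ (1 / (n : ℝ))) := by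
  obtain ⟨K, hK0, hK⟩ := exists_norm_subdiv_le hL hA
  have h1 : ∀ n k, ‖(subdiv L A)^[n] dirac k‖ ≤ K ^ n := by
    intro n
    induction n with
    | zero =>
      intro k
      simp only [Function.iterate_zero, id_eq, pow_zero, dirac]
      split_ifs <;> simp
    | succ n ih =>
      intro k
      rw [Function.iterate_succ_apply', pow_succ']
      exact hK _ _ ih k
  refine ⟨2 ^ J * K, eventually_map.mpr ?_⟩
  filter_upwards [eventually_ge_atTop 1] with n hn
  rw [rpow_one_div_le_iff (supNorm_nonneg _) (by positivity) (by omega), mul_pow]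
  refine (supNorm_le (norm_backDiff_iterate_le (h1 n) J)).trans ?_
  refine mul_le_mul_of_nonneg_right ?_ (by positivity)
  exact le_self_pow₀ (one_le_pow₀ one_le_two) (by omega)

theorem exists_decay_of_rhoInf_lt (hL : 0 < L) (hA : (Function.support A).Finite) {J : ℕ}
    {ρ : ℝ} (hρ : 0 < ρ) (h : rhoInf J A L < ρ) :
    ∃ C, ∀ n k, ‖backDiff^[J] ((subdiv L A)^[n] dirac) k‖ ≤ C * ρ ^ n := by
  have h1 := eventually_lt_of_limsup_lt h (isBoundedUnder_roots hL hA J)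
  obtain ⟨C, hC⟩ := exists_bound_of_eventually
    (d := fun n => supNorm (backDiff^[J] ((subdiv L A)^[n] dirac))) hρ (by
      filter_upwards [h1, eventually_ge_atTop 1] with n hn hn1
      exact (rpow_one_div_le_iff (supNorm_nonneg _) hρ.le (by omega)).mp hn.le)
  refine ⟨C, fun n k => (norm_le_supNorm ?_ k).trans (hC n)⟩
  exact finite_support_backDiff_iterate (finite_support_subdiv_iterate hA n) J

theorem rhoInf_lt_of_decay {J : ℕ} {ρ σ C : ℝ} (hρ : 0 < ρ) (hσ : ρ < σ)
    (h : ∀ n k, ‖backDiff^[J] ((subdiv L A)^[n] dirac) k‖ ≤ C * ρ ^ n) :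
    rhoInf J A L < σ := by
  obtain ⟨τ, hτ1, hτ2⟩ := exists_between hσ
  have hτ0 : 0 < τ := hρ.trans hτ1
  refine lt_of_le_of_lt (limsup_le_of_le ?_ ?_) hτ2
  · exact IsBoundedUnder.isCoboundedUnder_le
      ⟨0, eventually_map.mpr (Eventually.of_forall fun n =>
        Real.rpow_nonneg (supNorm_nonneg _) _)⟩
  · have h1 : Tendsto (fun n : ℕ => C * (ρ / τ) ^ n) atTop (𝓝 (C * 0)) :=
      (tendsto_pow_atTop_nhds_zero_of_lt_one (by positivity)
        ((div_lt_one hτ0).mpr hτ1)).const_mul C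
    rw [mul_zero] at h1
    filter_upwards [h1.eventually (ge_mem_nhds zero_lt_one), eventually_ge_atTop 1] with n hn hn1
    rw [rpow_one_div_le_iff (supNorm_nonneg _) hτ0.le (by omega)]
    refine (supNorm_le (h n)).trans ?_
    rw [div_pow, ← mul_div_assoc, div_le_one (pow_pos hτ0 n)] at hn
    exact hn

/-- The n-th iterate has mass L^n on O(L^n) points, and undoing J differences over that range costs
O(L^(nJ)); so the norms are at least a constant times L^(-nJ). Positivity is needed because
`Real.logb` takes the value 0 at 0. -/
theorem rhoInf_pos (hL : 2 ≤ L) (hA : (Function.support A).Finite) (hsum : ∑' k, A k = 1)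
    (J : ℕ) : 0 < rhoInf J A L := by
  have hL0 : (0 : ℝ) < L := by exact_mod_cast (by omega : 0 < L)
  obtain ⟨N, hN⟩ := exists_suppIn hA
  set B : ℝ := 2 * (N + J) + 1 with hB
  have hB1 : 1 ≤ B := by rw [hB]; linarith [(by positivity : (0 : ℝ) ≤ 2 * (N + J))]
  have hB0 : 0 < B := by linarith
  have key : ∀ n, 1 ≤ B ^ (J + 1) * ((L : ℝ) ^ J) ^ n *
      supNorm (backDiff^[J] ((subdiv L A)^[n] dirac)) := by
    intro n
    set u := (subdiv L A)^[n] dirac with hu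
    have hfin := finite_support_backDiff_iterate
      (finite_support_subdiv_iterate (L := L) hA n) J
    -- The trailing factor 1 presents the radius in units of the unit step, as the undoing of unit
    -- differences requires.
    have hsupp : SuppIn (N * L ^ n * 1) u := by
      rw [mul_one, hu, ← qsData_fin_one]
      exact suppIn_qsData_dirac hL (fun _ => hN) n
    have hsumu : ∑' k, u k = (L : ℂ) ^ n := by
      rw [hu, ← qsData_fin_one]
      exact tsum_qsData_dirac (fun _ => hA) (fun _ => hsum) n
    set E := supNorm (backDiff^[J] u) with hE
    have h1 := norm_le_of_shiftDiff_iterate_le one_pos J hsupp (E := E)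
      (fun k => norm_le_supNorm hfin k)
    rw [hsupp.tsum_eq] at hsumu
    have h2 : ((L : ℝ) ^ n) ≤ (2 * (N * L ^ n) + 1) * ((2 * (N * L ^ n + J) + 1) ^ J * E) := by
      have h3 := norm_sum_le_of_le (Finset.Icc (-((N * L ^ n * 1 : ℕ) : ℤ)) (N * L ^ n * 1 : ℕ))
        (fun k _ => h1 k)
      rw [hsumu, Finset.sum_const, nsmul_eq_mul, card_Icc_neg, norm_pow,
        Complex.norm_natCast] at h3
      push_cast at h3
      simpa using h3
    have hLn : (1 : ℝ) ≤ (L : ℝ) ^ n := one_le_pow₀ (by exact_mod_cast (by omega : 1 ≤ L))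
    have hE0 : 0 ≤ E := supNorm_nonneg _
    have hJ0 : (0 : ℝ) ≤ J := by positivity
    have hN0 : (0 : ℝ) ≤ N := by positivity
    have h4 : 2 * (N * (L : ℝ) ^ n) + 1 ≤ B * (L : ℝ) ^ n := by
      rw [hB]; nlinarith
    have h5 : 2 * (N * (L : ℝ) ^ n + J) + 1 ≤ B * (L : ℝ) ^ n := by
      rw [hB]; nlinarith
    have h6 : ((L : ℝ) ^ n) ≤ (B * (L : ℝ) ^ n) * ((B * (L : ℝ) ^ n) ^ J * E) :=
      h2.trans (by gcongr)
    have h7 : ((L : ℝ) ^ n) * 1 ≤ ((L : ℝ) ^ n) * (B ^ (J + 1) * ((L : ℝ) ^ J) ^ n * E) := by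
      calc ((L : ℝ) ^ n) * 1 = (L : ℝ) ^ n := mul_one _
        _ ≤ _ := h6
        _ = _ := by rw [mul_pow, ← pow_mul, ← pow_mul, mul_comm J n]; ring
    exact le_of_mul_le_mul_left h7 (by positivity)
  have hD : 0 < B ^ (J + 1) * (L : ℝ) ^ J := by positivity
  refine lt_of_lt_of_le (inv_pos.mpr hD) (le_limsup_of_frequently_le ?_
    (isBoundedUnder_roots (by omega) hA J))
  refine Eventually.frequently ?_
  filter_upwards [eventually_ge_atTop 1] with n hn
  rw [le_rpow_one_div_iff (supNorm_nonneg _) (by positivity) (by omega), inv_pow,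
    inv_le_iff_one_le_mul₀' (by positivity), mul_pow]
  refine (key n).trans ?_
  refine mul_le_mul_of_nonneg_right ?_ (supNorm_nonneg _)
  refine mul_le_mul_of_nonneg_right ?_ (by positivity)
  exact le_self_pow₀ (one_le_pow₀ hB1) (by omega)

theorem lt_smInf_iff (hL : 2 ≤ L) (hA : (Function.support A).Finite) (hsum : ∑' k, A k = 1)
    (m : ℕ) : (m : ℝ) < smInf A L ↔ rhoInf (sr A L) A L < ((L : ℝ) ^ m)⁻¹ := by
  have hL1 : (1 : ℝ) < L := by exact_mod_cast (by omega : 1 < L)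
  rw [smInf, lt_neg, Real.logb_lt_iff_lt_rpow hL1 (rhoInf_pos hL hA hsum _),
    Real.rpow_neg (by linarith), Real.rpow_natCast]

theorem ne_zero_of_tsum (hsum : ∑' k, A k = 1) : A ≠ 0 := by
  rintro rfl
  simp at hsum

/-- The exponent is defined with differences of order `sr`, possibly more than m + 1; the extra
differences cost only a constant factor. -/
theorem lt_smInf_of_decay (hL : 2 ≤ L) (hA : (Function.support A).Finite)
    (hsum : ∑' k, A k = 1) {m : ℕ} (hs : HasSumRules A L (m + 1)) {ρ C : ℝ} (hρ : 0 < ρ)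
    (hρm : ρ < ((L : ℝ) ^ m)⁻¹)
    (h : ∀ n k, ‖backDiff^[m + 1] ((subdiv L A)^[n] dirac) k‖ ≤ C * ρ ^ n) :
    (m : ℝ) < smInf A L := by
  rw [lt_smInf_iff hL hA hsum]
  have hJ : m + 1 ≤ sr A L := (lt_sr_iff hL hA (ne_zero_of_tsum hsum) m).mpr hs
  obtain ⟨d, hd⟩ := Nat.exists_eq_add_of_le' hJ
  refine rhoInf_lt_of_decay (C := 2 ^ d * C) hρ hρm fun n k => ?_
  rw [hd, Function.iterate_add_apply, mul_assoc]
  exact norm_backDiff_iterate_le (h n) d k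

/-- Descent from order `sr` to m + 1. Every intermediate order j is at least m + 1, so ρ exceeds
L^(-j) at each step. -/
theorem exists_decay_of_lt_smInf (hL : 2 ≤ L) (hA : (Function.support A).Finite)
    (hsum : ∑' k, A k = 1) {m : ℕ} (hm : m + 1 ≤ sr A L) {ρ : ℝ}
    (hρ : ((L : ℝ) ^ (m + 1))⁻¹ < ρ) (h : rhoInf (sr A L) A L < ρ) :
    ∃ C, ∀ n k, ‖backDiff^[m + 1] ((subdiv L A)^[n] dirac) k‖ ≤ C * ρ ^ n := by
  have hL0 : (1 : ℝ) ≤ L := by exact_mod_cast (by omega : 1 ≤ L)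
  have hρ0 : 0 < ρ := lt_trans (by positivity) hρ
  have hsr := hasSumRules_sr hL hA (ne_zero_of_tsum hsum)
  refine Nat.decreasingInduction'
    (P := fun j => ∃ C, ∀ n k, ‖backDiff^[j] ((subdiv L A)^[n] dirac) k‖ ≤ C * ρ ^ n)
    ?_ hm (exists_decay_of_rhoInf_lt (by omega) hA hρ0 h)
  intro j hj hmj ih
  simp only [← qsData_fin_one] at ih ⊢
  refine decay_backDiff_of_decay_succ (by omega) (fun _ => hA) (fun _ => hsum)
    (fun _ => HasSumRules.mono hA hsr hj) ?_ (lt_of_le_of_lt ?_ hρ) ih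
  · exact ⟨_, norm_le_supNorm (finite_support_backDiff_iterate finite_support_dirac j)⟩
  · gcongr

end stationary

/-! ### From whole periods to all levels -/

section scheme

variable {r : ℕ} [NeZero r] {M : ℕ} {a : Fin r → ℤ → ℂ}

theorem exists_norm_backDiff_qsData_le (hM : 0 < M) (ha : ∀ l, (Function.support (a l)).Finite)
    {J : ℕ} (hs : ∀ l, HasSumRules (a l) M J) :
    ∃ K : ℝ, 0 ≤ K ∧ ∀ (v : ℤ → ℂ) (n : ℕ) (E : ℝ),
      (∀ k, ‖backDiff^[J] (qsData M a v n) k‖ ≤ E) →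
        ∀ k, ‖backDiff^[J] (qsData M a v (n + 1)) k‖ ≤ K * E := by
  choose c hc hac using fun l => (hasSumRules_iff (ha l) M J).mp (hs l)
  obtain ⟨K, hK0, hK⟩ := exists_uniform_bound
    (P := fun l K => ∀ (v : ℤ → ℂ) (E : ℝ), (∀ k, ‖v k‖ ≤ E) →
      ∀ k, ‖subdiv M (c l) v k‖ ≤ K * E)
    (fun l C C' hCC h v E hE k => (h v E hE k).trans
      (mul_le_mul_of_nonneg_right hCC ((norm_nonneg _).trans (hE 0))))
    (fun l => exists_norm_subdiv_le hM (hc l))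
  refine ⟨K, hK0, fun v n E hE k => ?_⟩
  rw [qsData, hac, backDiff_iterate_subdiv_box hM (hc _)]
  exact hK _ _ E hE k

/-- A level lies fewer than r steps after a period boundary, and by the sum rules each step acts
boundedly on J-th differences. -/
theorem exists_decay_of_decay_mul (hM : 0 < M) (ha : ∀ l, (Function.support (a l)).Finite)
    {J : ℕ} (hs : ∀ l, HasSumRules (a l) M J) {v : ℤ → ℂ} {θ : ℝ} (hθ : 0 < θ) (hθ1 : θ ≤ 1)
    (h : ∃ C, ∀ q k, ‖backDiff^[J] (qsData M a v (r * q)) k‖ ≤ C * (θ ^ r) ^ q) :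
    ∃ C, ∀ n k, ‖backDiff^[J] (qsData M a v n) k‖ ≤ C * θ ^ n := by
  obtain ⟨K, hK0, hK⟩ := exists_norm_backDiff_qsData_le hM ha hs
  obtain ⟨C, hC⟩ := h
  have hC0 : 0 ≤ C := by simpa using (norm_nonneg _).trans (hC 0 0)
  set K' := max K 1 with hK'
  have hK'1 : 1 ≤ K' := le_max_right _ _
  have h1 : ∀ q s k, ‖backDiff^[J] (qsData M a v (r * q + s)) k‖ ≤ K' ^ s * (C * (θ ^ r) ^ q) := by
    intro q s
    induction s with
    | zero => intro k; simpa using hC q k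
    | succ s ih =>
      intro k
      refine (hK v _ _ ih k).trans ?_
      rw [pow_succ', mul_assoc]
      exact mul_le_mul_of_nonneg_right (le_max_left _ _) (by positivity)
  refine ⟨K' ^ r * C * (θ ^ r)⁻¹, fun n k => ?_⟩
  have hr : n % r < r := Nat.mod_lt _ (NeZero.pos r)
  have h2 := h1 (n / r) (n % r) k
  rw [Nat.div_add_mod] at h2
  refine h2.trans ?_
  have h3 : θ ^ n = (θ ^ r) ^ (n / r) * θ ^ (n % r) := by
    rw [← pow_mul, ← pow_add, Nat.div_add_mod]
  have h4 : θ ^ r ≤ θ ^ (n % r) := pow_le_pow_of_le_one hθ.le hθ1 hr.le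
  have h5 : K' ^ (n % r) ≤ K' ^ r := pow_le_pow_right₀ hK'1 hr.le
  calc K' ^ (n % r) * (C * (θ ^ r) ^ (n / r)) ≤ K' ^ r * (C * (θ ^ r) ^ (n / r)) := by gcongr
    _ = K' ^ r * C * (θ ^ r)⁻¹ * ((θ ^ r) ^ (n / r) * θ ^ r) := by field_simp
    _ ≤ K' ^ r * C * (θ ^ r)⁻¹ * ((θ ^ r) ^ (n / r) * θ ^ (n % r)) := by gcongr
    _ = _ := by rw [h3]

theorem exists_decay_of_smInf_sr (hM : 2 ≤ M) (ha : ∀ l, (Function.support (a l)).Finite)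
    (hsum : ∀ l, ∑' k : ℤ, a l k = 1) {m : ℕ} (hsm : (m : ℝ) < smInf (compositeMask M a) (M ^ r))
    (hs : ∀ l, HasSumRules (a l) M (m + 1)) :
    ∃ θ C : ℝ, 0 < θ ∧ θ < ((M : ℝ) ^ m)⁻¹ ∧
      ∀ n k, ‖backDiff^[m + 1] (qsData M a dirac n) k‖ ≤ C * θ ^ n := by
  have hM0 : 0 < M := by omega
  have hM1 : (1 : ℝ) < M := by exact_mod_cast (by omega : 1 < M)
  have hL : 2 ≤ M ^ r := hM.trans (Nat.le_self_pow (NeZero.ne r) M)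
  have hA := finite_support_compositeMask (M := M) ha
  have hAsum := tsum_compositeMask hM0 ha hsum
  rw [lt_smInf_iff hL hA hAsum] at hsm
  have hAs : m + 1 ≤ sr (compositeMask M a) (M ^ r) :=
    (lt_sr_iff hL hA (ne_zero_of_tsum hAsum) m).mpr (hasSumRules_compositeMask hM0 ha hs)
  set θ₀ := ((M : ℝ) ^ m)⁻¹ with hθ₀
  have hpow : ∀ j : ℕ, (((M ^ r : ℕ) : ℝ) ^ j)⁻¹ = (((M : ℝ) ^ j)⁻¹) ^ r := by
    intro j
    rw [Nat.cast_pow, inv_pow, ← pow_mul, ← pow_mul, mul_comm]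
  rw [hpow m] at hsm
  have e1 : ∀ᶠ θ in 𝓝 θ₀, rhoInf (sr (compositeMask M a) (M ^ r)) (compositeMask M a) (M ^ r)
      < θ ^ r := (continuous_pow r).continuousAt.eventually (lt_mem_nhds hsm)
  have e2 : ∀ᶠ θ in 𝓝 θ₀, ((M : ℝ) ^ (m + 1))⁻¹ < θ := by
    refine lt_mem_nhds ?_
    rw [hθ₀]
    exact inv_strictAnti₀ (by positivity) (pow_lt_pow_right₀ hM1 (Nat.lt_succ_self m))
  -- θ is taken just below M^(-m): θ^r must still exceed the limsup, and θ must exceed M^(-(m+1))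
  -- for the descent in the order.
  obtain ⟨θ, ⟨hθ1, hθ2⟩, hθ3⟩ := (((e1.and e2).filter_mono nhdsWithin_le_nhds).and
    (eventually_mem_nhdsWithin (s := Set.Iio θ₀))).exists
  have hθ0 : 0 < θ := lt_trans (by positivity) hθ2
  have hθ4 : θ ≤ 1 := (le_of_lt hθ3).trans (inv_le_one_of_one_le₀ (one_le_pow₀ hM1.le))
  have hd := exists_decay_of_lt_smInf hL hA hAsum hAs (ρ := θ ^ r)
    (by rw [hpow]; exact pow_lt_pow_left₀ hθ2 (by positivity) (NeZero.ne r)) hθ1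
  simp only [subdiv_compositeMask_iterate hM0 ha] at hd
  obtain ⟨C, hC⟩ := exists_decay_of_decay_mul hM0 ha hs hθ0 hθ4 hd
  exact ⟨θ, C, hθ0, hθ3, hC⟩

end scheme

/-! ### Limits of refining data and their derivatives -/

theorem tendsto_floor_mul_pow_div {M : ℕ} (hM : 2 ≤ M) (x : ℝ) :
    Tendsto (fun n : ℕ => (⌊(M : ℝ) ^ n * x⌋ : ℝ) / (M : ℝ) ^ n) atTop (𝓝 x) := by
  have hM1 : (1 : ℝ) < M := by exact_mod_cast (by omega : 1 < M)
  have h1 : Tendsto (fun n : ℕ => ((M : ℝ) ^ n)⁻¹) atTop (𝓝 0) :=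
    (tendsto_pow_atTop_atTop_of_one_lt hM1).inv_tendsto_atTop
  rw [tendsto_iff_norm_sub_tendsto_zero]
  refine squeeze_zero (fun n => norm_nonneg _) (fun n => ?_) h1
  have hp : (0 : ℝ) < (M : ℝ) ^ n := by positivity
  rw [div_sub' hp.ne', norm_div, Real.norm_eq_abs, Real.norm_eq_abs, abs_of_pos hp,
    ← one_div]
  refine div_le_div_of_nonneg_right ?_ hp.le
  rw [abs_le]
  constructor <;> linarith [Int.floor_le ((M : ℝ) ^ n * x), Int.lt_floor_add_one ((M : ℝ) ^ n * x)]

theorem floor_pow_succ {M : ℕ} (hM : 0 < M) (x : ℝ) (n : ℕ) :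
    ∃ g : ℤ, 0 ≤ g ∧ g < M ∧ ⌊(M : ℝ) ^ (n + 1) * x⌋ = (M : ℤ) * ⌊(M : ℝ) ^ n * x⌋ + g := by
  have hM0 : (0 : ℝ) < M := by exact_mod_cast hM
  refine ⟨⌊(M : ℝ) ^ (n + 1) * x⌋ - (M : ℤ) * ⌊(M : ℝ) ^ n * x⌋, ?_, ?_, by ring⟩
  · rw [sub_nonneg, Int.le_floor, pow_succ']
    push_cast
    rw [mul_assoc]
    exact mul_le_mul_of_nonneg_left (Int.floor_le _) hM0.le
  · rw [sub_lt_iff_lt_add, Int.floor_lt, pow_succ']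
    push_cast
    nlinarith [Int.lt_floor_add_one ((M : ℝ) ^ n * x)]

theorem floor_cast_div_pow {M : ℕ} (hM : 0 < M) (k : ℤ) (n : ℕ) :
    ⌊(M : ℝ) ^ n * ((k : ℝ) / (M : ℝ) ^ n)⌋ = k := by
  have hM0 : (0 : ℝ) < M := by exact_mod_cast hM
  rw [mul_div_cancel₀ _ (pow_pos hM0 n).ne', Int.floor_intCast]

/-- Along ⌊M^n x⌋ consecutive indices are related by Mq + g with 0 ≤ g < M, so the values form a
geometric Cauchy sequence. Points closer than M^(-n) have level-n indices differing by at most one,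
which gives continuity. -/
theorem exists_limit_of_refinement {M : ℕ} (hM : 2 ≤ M) {w : ℕ → ℤ → ℂ} {C θ : ℝ}
    (hθ0 : 0 ≤ θ) (hθ1 : θ < 1)
    (hstep : ∀ n (q g : ℤ), 0 ≤ g → g < M → ‖w (n + 1) (M * q + g) - w n q‖ ≤ C * θ ^ n)
    (hjump : ∀ n k, ‖backDiff (w n) k‖ ≤ C * θ ^ n) :
    ∃ f : ℝ → ℂ, Continuous f ∧
      ∀ n (x : ℝ), ‖w n ⌊(M : ℝ) ^ n * x⌋ - f x‖ ≤ C * θ ^ n / (1 - θ) := by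
  have hM0 : (0 : ℝ) < M := by exact_mod_cast (by omega : 0 < M)
  have hd : ∀ x n, dist (w n ⌊(M : ℝ) ^ n * x⌋) (w (n + 1) ⌊(M : ℝ) ^ (n + 1) * x⌋)
      ≤ C * θ ^ n := by
    intro x n
    obtain ⟨g, hg0, hg, h⟩ := floor_pow_succ (by omega : 0 < M) x n
    rw [h, dist_comm, dist_eq_norm]
    exact hstep n _ g hg0 hg
  choose f hf using fun x => cauchySeq_tendsto_of_complete
    (cauchySeq_of_le_geometric θ C hθ1 (hd x))
  have hlim : ∀ n (x : ℝ), ‖w n ⌊(M : ℝ) ^ n * x⌋ - f x‖ ≤ C * θ ^ n / (1 - θ) := by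
    intro n x
    rw [← dist_eq_norm]
    exact dist_le_of_le_geometric_of_tendsto θ C hθ1 (hd x) (hf x) n
  refine ⟨f, Metric.continuous_iff.mpr fun x ε hε => ?_, hlim⟩
  have hz : Tendsto (fun n : ℕ => 2 * (C * θ ^ n / (1 - θ)) + C * θ ^ n) atTop (𝓝 0) := by
    have h1 := tendsto_pow_atTop_nhds_zero_of_lt_one hθ0 hθ1
    have h2 := (((h1.const_mul C).div_const (1 - θ)).const_mul 2).add (h1.const_mul C)
    simpa using h2
  obtain ⟨n, hn⟩ := (hz.eventually (gt_mem_nhds hε)).exists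
  have hp : (0 : ℝ) < (M : ℝ) ^ n := by positivity
  have hC0 : 0 ≤ C * θ ^ n := (norm_nonneg _).trans (hjump n 0)
  refine ⟨((M : ℝ) ^ n)⁻¹, by positivity, fun y hy => lt_of_le_of_lt ?_ hn⟩
  have h1 := norm_sub_le_of_backDiff_le (hjump n) ⌊(M : ℝ) ^ n * y⌋ ⌊(M : ℝ) ^ n * x⌋
  have h2 : |((⌊(M : ℝ) ^ n * y⌋ - ⌊(M : ℝ) ^ n * x⌋ : ℤ) : ℝ)| ≤ 1 := by
    rw [Real.dist_eq, abs_lt] at hy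
    have h3 : (M : ℝ) ^ n * (y - x) < 1 := by
      have := mul_lt_mul_of_pos_left hy.2 hp
      rwa [mul_inv_cancel₀ hp.ne'] at this
    have h4 : -1 < (M : ℝ) ^ n * (y - x) := by
      have := mul_lt_mul_of_pos_left hy.1 hp
      rwa [mul_neg, mul_inv_cancel₀ hp.ne'] at this
    have h5 : ⌊(M : ℝ) ^ n * y⌋ < ⌊(M : ℝ) ^ n * x⌋ + 2 := by
      rw [Int.floor_lt]; push_cast
      linarith [Int.lt_floor_add_one ((M : ℝ) ^ n * x)]
    have h6 : ⌊(M : ℝ) ^ n * x⌋ < ⌊(M : ℝ) ^ n * y⌋ + 2 := by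
      rw [Int.floor_lt]; push_cast
      linarith [Int.lt_floor_add_one ((M : ℝ) ^ n * y)]
    rw [← Int.cast_abs]
    rw [← Int.cast_one, Int.cast_le]
    exact abs_le.mpr ⟨by omega, by omega⟩
  have h7 : ‖w n ⌊(M : ℝ) ^ n * y⌋ - w n ⌊(M : ℝ) ^ n * x⌋‖ ≤ C * θ ^ n :=
    h1.trans (mul_le_of_le_one_left hC0 h2)
  have h8 := norm_sub_rev (w n ⌊(M : ℝ) ^ n * y⌋) (f y) ▸ hlim n y
  have h9 := hlim n x
  rw [dist_eq_norm]
  have h10 : f y - f x = (f y - w n ⌊(M : ℝ) ^ n * y⌋)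
      + (w n ⌊(M : ℝ) ^ n * y⌋ - w n ⌊(M : ℝ) ^ n * x⌋) + (w n ⌊(M : ℝ) ^ n * x⌋ - f x) := by ring
  rw [h10]
  refine norm_add₃_le.trans ?_
  linarith

theorem norm_sub_le_of_backDiff_le_on {w : ℤ → ℂ} {E : ℝ} {p p' : ℤ} (hp : p ≤ p')
    (hE : ∀ i, p < i → i ≤ p' → ‖backDiff w i‖ ≤ E) : ‖w p' - w p‖ ≤ (p' - p) * E := by
  induction p', hp using Int.leInduction with
  | base => simp
  | succ p' hp ih =>
    have h1 := ih fun i h1 h2 => hE i h1 (by omega)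
    have h2 := hE (p' + 1) (by omega) le_rfl
    simp only [backDiff, add_sub_cancel_right] at h2
    have := norm_add_le (w (p' + 1) - w p') (w p' - w p)
    rw [sub_add_sub_cancel] at this
    push_cast
    linarith

/-- A discrete mean value inequality: f(y) - f(x) is the limit of sums of increments, each close to
M^(-n) g. One ε comes from that approximation and one from the oscillation of g around c. -/
theorem norm_sub_sub_le_of_limit {M : ℕ} (hM : 2 ≤ M) {u : ℕ → ℤ → ℂ} {f g : ℝ → ℂ}
    (hf : ∀ x, Tendsto (fun n : ℕ => u n ⌊(M : ℝ) ^ n * x⌋) atTop (𝓝 (f x)))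
    (hg : ∀ ε : ℝ, 0 < ε → ∃ N, ∀ n, N ≤ n → ∀ k : ℤ,
      ‖(M : ℂ) ^ n * backDiff (u n) k - g ((k : ℝ) / (M : ℝ) ^ n)‖ ≤ ε)
    {x y : ℝ} (hxy : x ≤ y) {c : ℂ} {ε : ℝ} (hε : 0 < ε)
    (hc : ∀ t, x ≤ t → t ≤ y → ‖g t - c‖ ≤ ε) :
    ‖f y - f x - (y - x) * c‖ ≤ (y - x) * (2 * ε) := by
  have hM0 : (0 : ℝ) < M := by exact_mod_cast (by omega : 0 < M)
  obtain ⟨N, hN⟩ := hg ε hε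
  have hfx := tendsto_floor_mul_pow_div hM x
  have hfy := tendsto_floor_mul_pow_div hM y
  have hcast : ∀ z, Tendsto (fun n : ℕ => (⌊(M : ℝ) ^ n * z⌋ : ℝ) / (M : ℝ) ^ n) atTop (𝓝 z) →
      Tendsto (fun n : ℕ => (⌊(M : ℝ) ^ n * z⌋ : ℂ) / (M : ℂ) ^ n) atTop (𝓝 (z : ℂ)) := by
    intro z hz
    have := (Complex.continuous_ofReal.tendsto z).comp hz
    refine this.congr fun n => ?_
    simp
  have hl := (((hf y).sub (hf x)).sub (((hcast y hfy).sub (hcast x hfx)).mul_const c)).norm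
  have hr := (hfy.sub hfx).mul_const (2 * ε)
  refine le_of_tendsto_of_tendsto hl hr ?_
  filter_upwards [eventually_ge_atTop N] with n hn
  have hp : (0 : ℝ) < (M : ℝ) ^ n := by positivity
  have hpc : (M : ℂ) ^ n ≠ 0 := by
    have : (M : ℂ) ≠ 0 := by exact_mod_cast hM0.ne'
    exact pow_ne_zero n this
  have hfl : ⌊(M : ℝ) ^ n * x⌋ ≤ ⌊(M : ℝ) ^ n * y⌋ := Int.floor_mono (by gcongr)
  -- Subtracting the linear sequence of slope c leaves increments of size at most 2ε / M^n.
  have h1 := norm_sub_le_of_backDiff_le_on (w := fun k => u n k - (k : ℂ) / (M : ℂ) ^ n * c)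
    (E := (2 * ε) / (M : ℝ) ^ n) hfl (fun i hi1 hi2 => ?_)
  · refine (le_of_eq ?_).trans (h1.trans_eq ?_)
    · congr 1; ring
    · ring
  · have h2 : backDiff (fun k => u n k - (k : ℂ) / (M : ℂ) ^ n * c) i =
        ((M : ℂ) ^ n * backDiff (u n) i - c) / (M : ℂ) ^ n := by
      simp only [backDiff]
      push_cast
      field_simp
      ring
    rw [h2, norm_div, norm_pow, Complex.norm_natCast]
    refine div_le_div_of_nonneg_right ?_ hp.le
    have h3 := hN n hn i
    have h4 := hc ((i : ℝ) / (M : ℝ) ^ n)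
      (by rw [le_div_iff₀ hp, mul_comm]; exact (Int.floor_lt.mp hi1).le)
      (by rw [div_le_iff₀ hp, mul_comm]; exact Int.le_floor.mp hi2)
    have := norm_add_le ((M : ℂ) ^ n * backDiff (u n) i - g ((i : ℝ) / (M : ℝ) ^ n))
      (g ((i : ℝ) / (M : ℝ) ^ n) - c)
    rw [sub_add_sub_cancel] at this
    linarith

theorem hasDerivAt_of_limit {M : ℕ} (hM : 2 ≤ M) {u : ℕ → ℤ → ℂ} {f g : ℝ → ℂ}
    (hf : ∀ x, Tendsto (fun n : ℕ => u n ⌊(M : ℝ) ^ n * x⌋) atTop (𝓝 (f x)))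
    (hg : ∀ ε : ℝ, 0 < ε → ∃ N, ∀ n, N ≤ n → ∀ k : ℤ,
      ‖(M : ℂ) ^ n * backDiff (u n) k - g ((k : ℝ) / (M : ℝ) ^ n)‖ ≤ ε)
    (hgc : Continuous g) (x : ℝ) : HasDerivAt f (g x) x := by
  rw [hasDerivAt_iff_isLittleO, Asymptotics.isLittleO_iff]
  intro ε hε
  obtain ⟨δ, hδ, h⟩ := Metric.continuous_iff.mp hgc x (ε / 2) (by positivity)
  filter_upwards [Metric.ball_mem_nhds x hδ] with y hy
  rw [Metric.mem_ball, Real.dist_eq, abs_lt] at hy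
  have hball : ∀ t, |t - x| < δ → ‖g t - g x‖ ≤ ε / 2 := fun t ht => by
    rw [← dist_eq_norm]; exact (h t ht).le
  rw [Complex.real_smul, Complex.ofReal_sub, Real.norm_eq_abs]
  rcases le_total x y with hxy | hxy
  · have := norm_sub_sub_le_of_limit hM hf hg hxy (c := g x) (ε := ε / 2) (by positivity)
      (fun t h1 h2 => hball t (abs_lt.mpr ⟨by linarith, by linarith⟩))
    rw [abs_of_nonneg (sub_nonneg.mpr hxy)]
    linarith
  · have := norm_sub_sub_le_of_limit hM hf hg hxy (c := g x) (ε := ε / 2) (by positivity)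
      (fun t h1 h2 => hball t (abs_lt.mpr ⟨by linarith, by linarith⟩))
    rw [abs_of_nonpos (sub_nonpos.mpr hxy), ← norm_neg]
    have e : -(f y - f x - ((y : ℂ) - x) * g x) = f x - f y - ((x : ℂ) - y) * g x := by ring
    rw [e]
    linarith

/-! ### Sums of shifts and sufficiency of the conditions -/

/-- The sum `∑ v(k) f(x - k)` of shifts of `f`. -/
noncomputable def shiftSum (v : ℤ → ℂ) (f : ℝ → ℂ) (x : ℝ) : ℂ := ∑' k : ℤ, v k * f (x - k)

theorem shiftSum_eq_sum {f : ℝ → ℂ} {R : ℝ} (hf : ∀ y, R < |y| → f y = 0) (v : ℤ → ℂ) {T : ℕ}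
    {x : ℝ} (hx : |x| + R ≤ T) :
    shiftSum v f x = ∑ k ∈ Finset.Icc (-(T : ℤ)) T, v k * f (x - k) := by
  refine tsum_eq_sum fun k hk => ?_
  rw [hf, mul_zero]
  rw [Finset.mem_Icc, ← abs_le, not_le] at hk
  have hk' : (T : ℝ) < |(k : ℝ)| := by exact_mod_cast hk
  have := abs_sub_abs_le_abs_sub (k : ℝ) x
  rw [abs_sub_comm] at this
  linarith

theorem shiftSum_eventuallyEq {f : ℝ → ℂ} {R : ℝ} (hf : ∀ y, R < |y| → f y = 0) (v : ℤ → ℂ)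
    (x : ℝ) : ∃ T : ℕ, shiftSum v f =ᶠ[𝓝 x]
      fun y => ∑ k ∈ Finset.Icc (-(T : ℤ)) T, v k * f (y - k) := by
  obtain ⟨T, hT⟩ := exists_nat_ge (|x| + 1 + R)
  refine ⟨T, ?_⟩
  filter_upwards [Metric.ball_mem_nhds x one_pos] with y hy
  refine shiftSum_eq_sum hf v ?_
  rw [Metric.mem_ball, Real.dist_eq] at hy
  have := abs_sub_abs_le_abs_sub y x
  linarith

theorem continuous_shiftSum {f : ℝ → ℂ} (hc : Continuous f) {R : ℝ}
    (hf : ∀ y, R < |y| → f y = 0) (v : ℤ → ℂ) : Continuous (shiftSum v f) := by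
  rw [continuous_iff_continuousAt]
  intro x
  obtain ⟨T, hT⟩ := shiftSum_eventuallyEq hf v x
  refine ContinuousAt.congr ?_ hT.symm
  fun_prop

theorem hasDerivAt_shiftSum {f g : ℝ → ℂ} (hd : ∀ x, HasDerivAt f (g x) x) {R : ℝ}
    (hf : ∀ y, R < |y| → f y = 0) (hg : ∀ y, R < |y| → g y = 0) (v : ℤ → ℂ) (x : ℝ) :
    HasDerivAt (shiftSum v f) (shiftSum v g x) x := by
  obtain ⟨U, hU⟩ := exists_nat_ge (|x| + 1 + R)
  have h1 : shiftSum v f =ᶠ[𝓝 x] fun y => ∑ k ∈ Finset.Icc (-(U : ℤ)) U, v k * f (y - k) := by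
    filter_upwards [Metric.ball_mem_nhds x one_pos] with y hy
    refine shiftSum_eq_sum hf v ?_
    rw [Metric.mem_ball, Real.dist_eq] at hy
    have := abs_sub_abs_le_abs_sub y x
    linarith
  rw [shiftSum_eq_sum hg v (T := U) (by linarith)]
  refine HasDerivAt.congr_of_eventuallyEq ?_ h1
  refine HasDerivAt.fun_sum fun k _ => ?_
  exact ((hd (x - k)).comp_sub_const x k).const_mul (v k)

theorem backDiff_const_mul (c : ℂ) (v : ℤ → ℂ) (k : ℤ) :
    backDiff (fun k => c * v k) k = c * backDiff v k := by simp [backDiff, mul_sub]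

theorem SuppIn.backDiff_iterate {N : ℕ} {v : ℤ → ℂ} (h : SuppIn N v) (j : ℕ) :
    SuppIn (N + j) (backDiff^[j] v) := by
  induction j with
  | zero => exact h
  | succ j ih =>
    rw [Function.iterate_succ_apply', backDiff_eq_shiftDiff]
    have := SuppIn.shiftDiff (L := 1) (N := N + j) (u := backDiff^[j] v) (by rwa [mul_one])
    rw [mul_one] at this
    exact this

theorem iteratedDeriv_eq_of_hasDerivAt {F : ℕ → ℝ → ℂ} {m : ℕ}
    (h : ∀ j < m, ∀ x, HasDerivAt (F j) (F (j + 1) x) x) {j : ℕ} (hj : j ≤ m) :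
    iteratedDeriv j (F 0) = F j := by
  induction j with
  | zero => exact iteratedDeriv_zero
  | succ j ih =>
    rw [iteratedDeriv_succ, ih (by omega)]
    funext x
    exact (h j (by omega) x).deriv

theorem contDiff_of_hasDerivAt {F : ℕ → ℝ → ℂ} {m : ℕ}
    (h : ∀ j < m, ∀ x, HasDerivAt (F j) (F (j + 1) x) x) (hc : ∀ j ≤ m, Continuous (F j)) :
    ContDiff ℝ m (F 0) := by
  rw [contDiff_nat_iff_iteratedDeriv]
  refine ⟨fun j hj => ?_, fun j hj x => ?_⟩
  · rw [iteratedDeriv_eq_of_hasDerivAt h hj]; exact hc j hj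
  · rw [iteratedDeriv_eq_of_hasDerivAt h hj.le]; exact (h j hj x).differentiableAt

section scheme

variable {r : ℕ} [NeZero r] {M : ℕ} {a : Fin r → ℤ → ℂ}

theorem backDiff_iterate_qsData_eq_tsum (hM : 0 < M)
    (ha : ∀ l, (Function.support (a l)).Finite) (v : ℤ → ℂ) (j n : ℕ) (k : ℤ) :
    backDiff^[j] (qsData M a v n) k =
      ∑' i : ℤ, v i * backDiff^[j] (qsData M a dirac n) (k - (M : ℤ) ^ n * i) := by
  induction j generalizing k with
  | zero => exact qsData_eq_tsum hM ha v n k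
  | succ j ih =>
    have hfin := finite_support_backDiff_iterate
      (finite_support_qsData ha finite_support_dirac n (M := M)) j
    have hs := summable_subdiv (pow_pos hM n) hfin v
    push_cast at hs
    rw [Function.iterate_succ_apply', Function.iterate_succ_apply']
    simp only [backDiff]
    rw [ih, ih, ← (hs k).tsum_sub (hs (k - 1))]
    refine tsum_congr fun i => ?_
    rw [← mul_sub, sub_right_comm k 1]

/-- The rate for ∇^(j+2) is below M^(-(j+1)); relaxing it to a σ between M^(-(j+1)) and M^(-j)
permits the descent to ∇^(j+1). -/
theorem exists_decay_backDiff (hM : 2 ≤ M) (ha : ∀ l, (Function.support (a l)).Finite)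
    (hsum : ∀ l, ∑' k : ℤ, a l k = 1) {m : ℕ} (hs : ∀ l, HasSumRules (a l) M (m + 1))
    {θ C : ℝ} (hθ0 : 0 < θ) (hθ : θ < ((M : ℝ) ^ m)⁻¹)
    (hC : ∀ n k, ‖backDiff^[m + 1] (qsData M a dirac n) k‖ ≤ C * θ ^ n) {j : ℕ} (hj : j ≤ m) :
    ∃ ρ C : ℝ, 0 < ρ ∧ ρ < ((M : ℝ) ^ j)⁻¹ ∧
      ∀ n k, ‖backDiff^[j + 1] (qsData M a dirac n) k‖ ≤ C * ρ ^ n := by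
  have hM1 : (1 : ℝ) < M := by exact_mod_cast (by omega : 1 < M)
  refine Nat.decreasingInduction' (P := fun j => ∃ ρ C : ℝ, 0 < ρ ∧ ρ < ((M : ℝ) ^ j)⁻¹ ∧
      ∀ n k, ‖backDiff^[j + 1] (qsData M a dirac n) k‖ ≤ C * ρ ^ n) ?_ hj ⟨θ, C, hθ0, hθ, hC⟩
  rintro j hjm - ⟨ρ, C, hρ0, hρ, hC⟩
  have hlt : ((M : ℝ) ^ (j + 1))⁻¹ < ((M : ℝ) ^ j)⁻¹ :=
    inv_strictAnti₀ (by positivity) (pow_lt_pow_right₀ hM1 (Nat.lt_succ_self j))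
  obtain ⟨σ, hσ1, hσ2⟩ := exists_between hlt
  have hC0 : 0 ≤ C := by simpa using (norm_nonneg _).trans (hC 0 0)
  obtain ⟨C', hC'⟩ := decay_backDiff_of_decay_succ (by omega) ha hsum (j := j + 1) (v := dirac)
    (fun l => HasSumRules.mono (ha l) (hs l) (by omega))
    ⟨_, norm_le_supNorm (finite_support_backDiff_iterate finite_support_dirac _)⟩ hσ1
    ⟨C, fun n k => (hC n k).trans (by gcongr; exact (hρ.trans hσ1).le)⟩
  exact ⟨σ, C', hρ0.trans (hρ.trans hσ1), hσ2, hC'⟩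

/-- Rescaling by M^(jn) changes the rate to θ = M^j ρ < 1, which controls both the change between
levels and the jumps within a level. -/
theorem exists_limit_backDiff (hM : 2 ≤ M) (ha : ∀ l, (Function.support (a l)).Finite)
    (hsum : ∀ l, ∑' k : ℤ, a l k = 1) {j : ℕ} (hs : ∀ l, HasSumRules (a l) M (j + 1))
    {ρ C : ℝ} (hρ0 : 0 < ρ) (hρ : ρ < ((M : ℝ) ^ j)⁻¹)
    (hC : ∀ n k, ‖backDiff^[j + 1] (qsData M a dirac n) k‖ ≤ C * ρ ^ n) :
    ∃ f : ℝ → ℂ, Continuous f ∧ ∀ ε : ℝ, 0 < ε → ∃ N : ℕ, ∀ n, N ≤ n → ∀ x : ℝ,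
      ‖(M : ℂ) ^ (j * n) * backDiff^[j] (qsData M a dirac n) ⌊(M : ℝ) ^ n * x⌋ - f x‖ ≤ ε := by
  have hM0 : (0 : ℝ) < M := by exact_mod_cast (by omega : 0 < M)
  obtain ⟨C₁, hC₁0, hC₁⟩ := exists_norm_backDiff_qsData_sub_le (by omega : 0 < M) ha hsum hs
  have hC0 : 0 ≤ C := by simpa using (norm_nonneg _).trans (hC 0 0)
  set θ := (M : ℝ) ^ j * ρ with hθ
  have hθ0 : 0 ≤ θ := by positivity
  have hθ1 : θ < 1 := by
    have := mul_lt_mul_of_pos_left hρ (pow_pos hM0 j)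
    rwa [mul_inv_cancel₀ (pow_pos hM0 j).ne'] at this
  have hθn : ∀ n, (M : ℝ) ^ (j * n) * ρ ^ n = θ ^ n := fun n => by rw [hθ, mul_pow, pow_mul]
  set w : ℕ → ℤ → ℂ := fun n k => (M : ℂ) ^ (j * n) * backDiff^[j] (qsData M a dirac n) k with hw
  obtain ⟨f, hf, hlim⟩ := exists_limit_of_refinement hM (w := w) (C := max (C₁ * C) C) hθ0 hθ1
    (by
      intro n q g hg0 hg
      have h1 := hC₁ dirac n _ (hC n) q g hg0 hg
      have h2 : w (n + 1) (M * q + g) - w n q = (M : ℂ) ^ (j * n) *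
          ((M : ℂ) ^ j * backDiff^[j] (qsData M a dirac (n + 1)) (M * q + g)
            - backDiff^[j] (qsData M a dirac n) q) := by
        simp only [hw]; ring
      rw [h2, norm_mul, norm_pow, Complex.norm_natCast]
      calc _ ≤ (M : ℝ) ^ (j * n) * (C₁ * (C * ρ ^ n)) := by gcongr
        _ = C₁ * C * θ ^ n := by rw [← hθn]; ring
        _ ≤ _ := by gcongr; exact le_max_left _ _)
    (by
      intro n k
      have h1 : backDiff (w n) k =
          (M : ℂ) ^ (j * n) * backDiff^[j + 1] (qsData M a dirac n) k := by
        rw [Function.iterate_succ_apply']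
        exact backDiff_const_mul _ _ k
      rw [h1, norm_mul, norm_pow, Complex.norm_natCast]
      calc _ ≤ (M : ℝ) ^ (j * n) * (C * ρ ^ n) := by gcongr; exact hC n k
        _ = C * θ ^ n := by rw [← hθn]; ring
        _ ≤ _ := by gcongr; exact le_max_right _ _)
  refine ⟨f, hf, fun ε hε => ?_⟩
  have hz : Tendsto (fun n : ℕ => max (C₁ * C) C * θ ^ n / (1 - θ)) atTop (𝓝 0) := by
    have h1 := tendsto_pow_atTop_nhds_zero_of_lt_one hθ0 hθ1
    simpa using (h1.const_mul (max (C₁ * C) C)).div_const (1 - θ)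
  obtain ⟨N, hN⟩ := eventually_atTop.mp (hz.eventually (ge_mem_nhds hε))
  exact ⟨N, fun n hn x => (hlim n x).trans (hN n hn)⟩

theorem backDiff_qsData_dirac_eq_zero (hM : 2 ≤ M) {N : ℕ} (hN : ∀ l, SuppIn N (a l)) {j m : ℕ}
    (hj : j ≤ m) {n : ℕ} {k : ℤ} (hk : (M : ℝ) ^ n * (N + m) < |(k : ℝ)|) :
    backDiff^[j] (qsData M a dirac n) k = 0 := by
  refine (suppIn_qsData_dirac hM hN n).backDiff_iterate j k ?_
  have h1 : (1 : ℝ) ≤ (M : ℝ) ^ n := one_le_pow₀ (by exact_mod_cast (by omega : 1 ≤ M))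
  have h2 : (j : ℝ) ≤ m := by exact_mod_cast hj
  have h3 : ((N * M ^ n + j : ℕ) : ℝ) < |(k : ℝ)| := by
    push_cast
    have : (m : ℝ) ≤ (M : ℝ) ^ n * m := le_mul_of_one_le_left (by positivity) h1
    linarith
  exact_mod_cast h3

theorem backDiff_qsData_dirac_floor_eq_zero (hM : 2 ≤ M) {N : ℕ} (hN : ∀ l, SuppIn N (a l))
    {j m : ℕ} (hj : j ≤ m) (n : ℕ) {y : ℝ} (hy : (N : ℝ) + m + 1 < |y|) :
    backDiff^[j] (qsData M a dirac n) ⌊(M : ℝ) ^ n * y⌋ = 0 := by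
  refine backDiff_qsData_dirac_eq_zero hM hN hj ?_
  have h1 : (1 : ℝ) ≤ (M : ℝ) ^ n := one_le_pow₀ (by exact_mod_cast (by omega : 1 ≤ M))
  have h2 : (M : ℝ) ^ n * (N + m + 1) < |(M : ℝ) ^ n * y| := by
    rw [abs_mul, abs_of_pos (by linarith : (0 : ℝ) < (M : ℝ) ^ n)]
    gcongr
  have h3 : |(M : ℝ) ^ n * y| - |(⌊(M : ℝ) ^ n * y⌋ : ℝ)| ≤ 1 := by
    refine (abs_sub_abs_le_abs_sub _ _).trans ?_
    rw [abs_le]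
    constructor <;>
      linarith [Int.floor_le ((M : ℝ) ^ n * y), Int.lt_floor_add_one ((M : ℝ) ^ n * y)]
  linarith

theorem isConvergent_of_decay (hM : 2 ≤ M) (ha : ∀ l, (Function.support (a l)).Finite)
    (hsum : ∀ l, ∑' k : ℤ, a l k = 1) {m : ℕ} (hs : ∀ l, HasSumRules (a l) M (m + 1))
    {θ C : ℝ} (hθ0 : 0 < θ) (hθ : θ < ((M : ℝ) ^ m)⁻¹)
    (hC : ∀ n k, ‖backDiff^[m + 1] (qsData M a dirac n) k‖ ≤ C * θ ^ n) :
    IsConvergent M m a := by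
  have hM0 : (0 : ℝ) < M := by exact_mod_cast (by omega : 0 < M)
  obtain ⟨N, hN⟩ := exists_suppIn_family ha
  have hex : ∀ j, ∃ f : ℝ → ℂ, j ≤ m → Continuous f ∧ ∀ ε : ℝ, 0 < ε →
      ∃ N : ℕ, ∀ n, N ≤ n → ∀ x : ℝ, ‖(M : ℂ) ^ (j * n) *
        backDiff^[j] (qsData M a dirac n) ⌊(M : ℝ) ^ n * x⌋ - f x‖ ≤ ε := by
    intro j
    by_cases hj : j ≤ m
    · obtain ⟨ρ, C', hρ0, hρ, hC'⟩ := exists_decay_backDiff hM ha hsum hs hθ0 hθ hC hj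
      obtain ⟨f, hf⟩ := exists_limit_backDiff hM ha hsum
        (fun l => HasSumRules.mono (ha l) (hs l) (by omega)) hρ0 hρ hC'
      exact ⟨f, fun _ => hf⟩
    · exact ⟨0, fun h => absurd h hj⟩
  choose f hf using hex
  have htend : ∀ j ≤ m, ∀ x, Tendsto (fun n : ℕ => (M : ℂ) ^ (j * n) *
      backDiff^[j] (qsData M a dirac n) ⌊(M : ℝ) ^ n * x⌋) atTop (𝓝 (f j x)) := by
    intro j hj x
    rw [Metric.tendsto_atTop]
    intro ε hε
    obtain ⟨n₀, hn₀⟩ := (hf j hj).2 (ε / 2) (by positivity)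
    refine ⟨n₀, fun n hn => ?_⟩
    rw [dist_eq_norm]
    exact (hn₀ n hn x).trans_lt (by linarith)
  have hunif : ∀ j ≤ m, ∀ ε : ℝ, 0 < ε → ∃ n₀ : ℕ, ∀ n, n₀ ≤ n → ∀ k : ℤ,
      ‖(M : ℂ) ^ (j * n) * backDiff^[j] (qsData M a dirac n) k
        - f j ((k : ℝ) / (M : ℝ) ^ n)‖ ≤ ε := by
    intro j hj ε hε
    obtain ⟨n₀, hn₀⟩ := (hf j hj).2 ε hε
    refine ⟨n₀, fun n hn k => ?_⟩
    have := hn₀ n hn ((k : ℝ) / (M : ℝ) ^ n)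
    rwa [floor_cast_div_pow (by omega : 0 < M)] at this
  have hderiv : ∀ j < m, ∀ x, HasDerivAt (f j) (f (j + 1) x) x := by
    intro j hj x
    refine hasDerivAt_of_limit hM
      (u := fun n k => (M : ℂ) ^ (j * n) * backDiff^[j] (qsData M a dirac n) k)
      (htend j hj.le) (fun ε hε => ?_) (hf (j + 1) hj).1 x
    obtain ⟨n₀, hn₀⟩ := hunif (j + 1) hj ε hε
    refine ⟨n₀, fun n hn k => ?_⟩
    have h1 := hn₀ n hn k
    rw [Function.iterate_succ_apply'] at h1
    rw [backDiff_const_mul, ← mul_assoc, ← pow_add, add_comm n, ← Nat.succ_mul]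
    exact h1
  set R : ℝ := N + m + 1 with hR
  have hfzero : ∀ j ≤ m, ∀ y, R < |y| → f j y = 0 := by
    intro j hj y hy
    refine tendsto_nhds_unique (htend j hj y) (tendsto_const_nhds.congr fun n => ?_)
    rw [backDiff_qsData_dirac_floor_eq_zero hM hN hj n hy, mul_zero]
  intro v
  have hD : ∀ j < m, ∀ x, HasDerivAt (shiftSum v (f j)) (shiftSum v (f (j + 1)) x) x :=
    fun j hj x => hasDerivAt_shiftSum (hderiv j hj) (hfzero j hj.le) (hfzero (j + 1) hj) v x
  refine ⟨shiftSum v (f 0), contDiff_of_hasDerivAt (F := fun j => shiftSum v (f j)) hD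
    (fun j hj => continuous_shiftSum (hf j hj).1 (hfzero j hj) v), ?_⟩
  intro K hK j hj ε hε
  rw [iteratedDeriv_eq_of_hasDerivAt (F := fun j => shiftSum v (f j)) hD hj]
  -- On [-K, K] only translates with |i| ≤ T contribute, at every level and in the limit.
  obtain ⟨T, hT⟩ := exists_nat_ge (K + R)
  set V := ∑ i ∈ Finset.Icc (-(T : ℤ)) T, ‖v i‖ with hV
  have hV0 : 0 ≤ V := Finset.sum_nonneg fun _ _ => norm_nonneg _
  obtain ⟨n₀, hn₀⟩ := hunif j hj (ε / (V + 1)) (by positivity)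
  refine ⟨n₀, fun n hn k hk => ?_⟩
  have hp : (0 : ℝ) < (M : ℝ) ^ n := by positivity
  have hkK : |(k : ℝ) / (M : ℝ) ^ n| ≤ K := by
    rw [abs_div, abs_of_pos hp, div_le_iff₀ hp, mul_comm]; exact hk
  rw [shiftSum_eq_sum (hfzero j hj) v (T := T) (by linarith),
    backDiff_iterate_qsData_eq_tsum (by omega : 0 < M) ha,
    tsum_eq_sum (s := Finset.Icc (-(T : ℤ)) T), Finset.mul_sum, ← Finset.sum_sub_distrib]
  · calc _ ≤ ∑ i ∈ Finset.Icc (-(T : ℤ)) T, ‖v i‖ * (ε / (V + 1)) := by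
          refine norm_sum_le_of_le _ fun i _ => ?_
          have h1 := hn₀ n hn (k - (M : ℤ) ^ n * i)
          have h2 : (((k - (M : ℤ) ^ n * i : ℤ) : ℝ)) / (M : ℝ) ^ n = (k : ℝ) / (M : ℝ) ^ n - i := by
            push_cast
            field_simp
          rw [h2] at h1
          rw [mul_left_comm, ← mul_sub, norm_mul]
          gcongr
      _ = V * (ε / (V + 1)) := by rw [← Finset.sum_mul]
      _ ≤ ε := by
          rw [← mul_div_assoc, div_le_iff₀ (by positivity)]
          nlinarith
  · intro i hi
    rw [backDiff_qsData_dirac_eq_zero hM hN hj, mul_zero]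
    rw [Finset.mem_Icc, ← abs_le, not_le] at hi
    have hi' : (T : ℝ) < |(i : ℝ)| := by exact_mod_cast hi
    have h1 := abs_sub_abs_le_abs_sub ((M : ℝ) ^ n * i) k
    rw [abs_mul, abs_of_pos hp, abs_sub_comm] at h1
    have h2 : (M : ℝ) ^ n * (K + R) < (M : ℝ) ^ n * |(i : ℝ)| := by
      gcongr; linarith
    push_cast
    rw [hR] at h2
    linarith

end scheme

/-! ### Riemann sums and a geometric bound -/

theorem tsum_eq_sum_range {d : ℤ → ℂ} {R : ℕ} (hd : SuppIn R d) :
    ∑' k, d k = ∑ i ∈ Finset.range (2 * R + 1), d ((i : ℤ) - R) := by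
  rw [← (Equiv.subRight (R : ℤ)).tsum_eq,
    tsum_eq_sum (s := (Finset.range (2 * R + 1)).map Nat.castEmbedding)]
  · simp
  · intro k hk
    refine hd _ ?_
    by_contra hlt
    refine hk ?_
    rw [not_lt, Equiv.subRight_apply, abs_le] at hlt
    simp only [Finset.mem_map, Finset.mem_range, Nat.castEmbedding_apply]
    exact ⟨k.toNat, by omega, by omega⟩

theorem tendsto_riemann_sum {M : ℕ} (hM : 2 ≤ M) {g : ℝ → ℂ} (hg : Continuous g) {R : ℕ}
    (hgz : ∀ y, (R : ℝ) < |y| → g y = 0) {d : ℕ → ℤ → ℂ} (hdz : ∀ n, SuppIn (R * M ^ n) (d n))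
    (hd : ∀ ε : ℝ, 0 < ε → ∃ n₀, ∀ n, n₀ ≤ n → ∀ k : ℤ,
      ‖d n k - g ((k : ℝ) / (M : ℝ) ^ n)‖ ≤ ε) :
    Tendsto (fun n => ((M : ℂ) ^ n)⁻¹ * ∑' k, d n k) atTop (𝓝 (∫ x, g x)) := by
  have hM1 : (1 : ℝ) < M := by exact_mod_cast (by omega : 1 < M)
  have hcs : HasCompactSupport g := by
    refine HasCompactSupport.of_support_subset_isCompact (isCompact_Icc (a := -(R : ℝ)) (b := R))
      fun y hy => ?_
    rw [Set.mem_Icc, ← abs_le]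
    by_contra h
    exact hy (hgz y (not_le.mp h))
  have huc := hcs.uniformContinuous_of_continuous hg
  rw [Metric.tendsto_atTop]
  intro ε hε
  -- Bounds the total length (2T + 1) M^(-n) = 2(R + 1) + M^(-n) of the partition at every level.
  set S : ℝ := 2 * R + 3 with hS
  have hS0 : 0 < S := by positivity
  set η := ε / (4 * S) with hη
  have hη0 : 0 < η := by positivity
  obtain ⟨n₀, hn₀⟩ := hd η hη0
  obtain ⟨δ, hδ, hδ2⟩ := Metric.uniformContinuous_iff.mp huc η hη0
  have hinv : Tendsto (fun n : ℕ => ((M : ℝ) ^ n)⁻¹) atTop (𝓝 0) :=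
    (tendsto_pow_atTop_atTop_of_one_lt hM1).inv_tendsto_atTop
  obtain ⟨n₁, hn₁⟩ := eventually_atTop.mp (hinv.eventually (gt_mem_nhds hδ))
  refine ⟨max n₀ n₁, fun n hn => ?_⟩
  have hp : (0 : ℝ) < (M : ℝ) ^ n := by positivity
  have hpc : ((M : ℝ) ^ n)⁻¹ < δ := hn₁ n (le_of_max_le_right hn)
  have hp1 : (1 : ℝ) ≤ (M : ℝ) ^ n := one_le_pow₀ hM1.le
  set T := (R + 1) * M ^ n with hT
  have hTsupp : SuppIn T (d n) := (hdz n).mono (Nat.mul_le_mul_right _ (Nat.le_succ R))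
  set p : ℕ → ℝ := fun i => ((i : ℝ) - T) / (M : ℝ) ^ n with hpdef
  have hstep : ∀ i, p (i + 1) - p i = ((M : ℝ) ^ n)⁻¹ := by
    intro i; simp only [hpdef]; push_cast; field_simp; ring
  have hTR : (T : ℝ) / (M : ℝ) ^ n = R + 1 := by
    rw [hT]; push_cast; field_simp
  have hint : ∫ x, g x = ∑ i ∈ Finset.range (2 * T + 1), ∫ x in p i..p (i + 1), g x := by
    rw [intervalIntegral.sum_integral_adjacent_intervals
      (fun k _ => hg.intervalIntegrable _ _)]
    symm
    refine intervalIntegral.integral_eq_integral_of_support_subset fun y hy => ?_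
    have hy' : |y| ≤ R := by
      by_contra h
      exact hy (hgz y (not_le.mp h))
    have h0 : p 0 = -((R : ℝ) + 1) := by
      simp only [hpdef]; rw [← hTR]; push_cast; ring
    have h1 : (R : ℝ) + 1 ≤ p (2 * T + 1) := by
      simp only [hpdef]; rw [← hTR]; push_cast; gcongr; linarith
    rw [abs_le] at hy'
    exact ⟨by rw [h0]; linarith, by linarith⟩
  have hterm : ∀ i ∈ Finset.range (2 * T + 1),
      ‖((M : ℂ) ^ n)⁻¹ * d n ((i : ℤ) - T) - ∫ x in p i..p (i + 1), g x‖
        ≤ 2 * η * ((M : ℝ) ^ n)⁻¹ := by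
    intro i _
    have h1 : ((M : ℂ) ^ n)⁻¹ * d n ((i : ℤ) - T) = ∫ x in p i..p (i + 1), d n ((i : ℤ) - T) := by
      rw [intervalIntegral.integral_const, hstep, Complex.real_smul]
      push_cast; rfl
    rw [h1, ← intervalIntegral.integral_sub (by simp) (hg.intervalIntegrable _ _)]
    have hle : p i ≤ p (i + 1) := by
      have := hstep i
      have : 0 < ((M : ℝ) ^ n)⁻¹ := by positivity
      linarith
    refine (intervalIntegral.norm_integral_le_of_norm_le_const (C := 2 * η) ?_).trans_eq ?_
    · intro x hx
      rw [Set.uIoc_of_le hle] at hx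
      have h2 := hn₀ n (le_of_max_le_left hn) ((i : ℤ) - T)
      have h3 : (((i : ℤ) - T : ℤ) : ℝ) / (M : ℝ) ^ n = p i := by simp [hpdef]
      rw [h3] at h2
      have h4 : dist (g (p i)) (g x) < η := by
        refine hδ2 ?_
        rw [Real.dist_eq, abs_sub_comm, abs_of_nonneg (by linarith [hx.1])]
        have := hstep i
        linarith [hx.2]
      rw [dist_eq_norm] at h4
      have := norm_add_le (d n ((i : ℤ) - T) - g (p i)) (g (p i) - g x)
      rw [sub_add_sub_cancel] at this
      linarith
    · rw [hstep, abs_of_pos (by positivity)]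
  rw [dist_eq_norm, hint, tsum_eq_sum_range hTsupp, Finset.mul_sum, ← Finset.sum_sub_distrib]
  refine (norm_sum_le_of_le _ hterm).trans_lt ?_
  rw [Finset.sum_const, nsmul_eq_mul, Finset.card_range]
  have h5 : ((2 * T + 1 : ℕ) : ℝ) * ((M : ℝ) ^ n)⁻¹ ≤ S := by
    rw [← div_eq_mul_inv, div_le_iff₀ hp, hT, hS]
    push_cast
    nlinarith
  calc ((2 * T + 1 : ℕ) : ℝ) * (2 * η * ((M : ℝ) ^ n)⁻¹)
      = 2 * η * (((2 * T + 1 : ℕ) : ℝ) * ((M : ℝ) ^ n)⁻¹) := by ring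
    _ ≤ 2 * η * S := by gcongr
    _ = ε / 2 := by rw [hη]; field_simp; norm_num
    _ < ε := by linarith

/-- Any ρ < 1 close enough to 1 that ρ^p > 1/2 works; C covers the first p terms. -/
theorem exists_geometric_bound {d : ℕ → ℝ} (hd0 : ∀ n, 0 ≤ d n) {p : ℕ} (hp : 1 ≤ p)
    (h : ∀ n, d (n + p) ≤ d n / 2) : ∃ ρ C : ℝ, 0 < ρ ∧ ρ < 1 ∧ ∀ n, d n ≤ C * ρ ^ n := by
  have e1 : ∀ᶠ ρ : ℝ in 𝓝 1, 1 / 2 < ρ ^ p :=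
    (continuous_pow p).continuousAt.eventually (lt_mem_nhds (by norm_num))
  have e2 : ∀ᶠ ρ : ℝ in 𝓝 1, 0 < ρ := lt_mem_nhds one_pos
  obtain ⟨ρ, ⟨hρ1, hρ0⟩, hρ2⟩ := (((e1.and e2).filter_mono nhdsWithin_le_nhds).and
    (eventually_mem_nhdsWithin (s := Set.Iio (1 : ℝ)))).exists
  have h0 : ∀ i ∈ Finset.range p, 0 ≤ d i / ρ ^ i := fun i _ => div_nonneg (hd0 i) (by positivity)
  set C := ∑ i ∈ Finset.range p, d i / ρ ^ i with hC
  have hC0 : 0 ≤ C := Finset.sum_nonneg h0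
  refine ⟨ρ, C, hρ0, hρ2, fun n => ?_⟩
  induction n using Nat.strong_induction_on with
  | _ n ih =>
    rcases lt_or_ge n p with hn | hn
    · rw [← div_le_iff₀ (by positivity)]
      exact Finset.single_le_sum h0 (Finset.mem_range.mpr hn)
    · obtain ⟨k, rfl⟩ := Nat.exists_eq_add_of_le' hn
      have h1 := ih k (by omega)
      have h2 : 0 ≤ C * ρ ^ k := by positivity
      calc d (k + p) ≤ d k / 2 := h k
        _ ≤ C * ρ ^ k * (1 / 2) := by linarith
        _ ≤ C * ρ ^ k * ρ ^ p := by gcongr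
        _ = C * ρ ^ (k + p) := by ring

/-! ### Properties of limit functions -/

section scheme

variable {r : ℕ} [NeZero r] {M m : ℕ} {a : Fin r → ℤ → ℂ}

theorem IsLimitFunction.continuous_iteratedDeriv {v : ℤ → ℂ} {η : ℝ → ℂ}
    (h : IsLimitFunction M m a v η) {j : ℕ} (hj : j ≤ m) : Continuous (iteratedDeriv j η) :=
  h.1.continuous_iteratedDeriv j (by exact_mod_cast hj)

theorem IsLimitFunction.tendsto_of_div_tendsto (hM : 0 < M) {v : ℤ → ℂ} {η : ℝ → ℂ}
    (h : IsLimitFunction M m a v η) {j : ℕ} (hj : j ≤ m) {p : ℕ → ℤ} {x : ℝ}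
    (hp : Tendsto (fun n => (p n : ℝ) / (M : ℝ) ^ n) atTop (𝓝 x)) :
    Tendsto (fun n => (M : ℂ) ^ (j * n) * backDiff^[j] (qsData M a v n) (p n)) atTop
      (𝓝 (iteratedDeriv j η x)) := by
  have hM0 : (0 : ℝ) < M := by exact_mod_cast hM
  have h1 := ((h.continuous_iteratedDeriv hj).tendsto x).comp hp
  have h2 : Tendsto (fun n => (M : ℂ) ^ (j * n) * backDiff^[j] (qsData M a v n) (p n)
      - iteratedDeriv j η ((p n : ℝ) / (M : ℝ) ^ n)) atTop (𝓝 0) := by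
    rw [Metric.tendsto_atTop]
    intro ε hε
    obtain ⟨n₀, hn₀⟩ := h.2 (|x| + 1) (by positivity) j hj (ε / 2) (by positivity)
    obtain ⟨n₁, hn₁⟩ := Metric.tendsto_atTop.mp hp 1 one_pos
    refine ⟨max n₀ n₁, fun n hn => ?_⟩
    have hpow : (0 : ℝ) < (M : ℝ) ^ n := by positivity
    have h3 := hn₁ n (le_of_max_le_right hn)
    rw [Real.dist_eq] at h3
    have h4 := abs_sub_abs_le_abs_sub ((p n : ℝ) / (M : ℝ) ^ n) x
    have h5 := hn₀ n (le_of_max_le_left hn) (p n) (by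
      have h6 : |(p n : ℝ) / (M : ℝ) ^ n| ≤ |x| + 1 := by linarith
      rw [abs_div, abs_of_pos hpow, div_le_iff₀ hpow, mul_comm] at h6
      exact h6)
    rw [dist_zero_right]
    exact h5.trans_lt (by linarith)
  simpa using h2.add h1

theorem IsLimitFunction.tendsto_floor (hM : 2 ≤ M) {v : ℤ → ℂ} {η : ℝ → ℂ}
    (h : IsLimitFunction M m a v η) {j : ℕ} (hj : j ≤ m) (x : ℝ) :
    Tendsto (fun n : ℕ => (M : ℂ) ^ (j * n) *
      backDiff^[j] (qsData M a v n) ⌊(M : ℝ) ^ n * x⌋) atTop (𝓝 (iteratedDeriv j η x)) :=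
  h.tendsto_of_div_tendsto (by omega) hj (tendsto_floor_mul_pow_div hM x)

theorem IsLimitFunction.iteratedDeriv_eq_zero (hM : 2 ≤ M) {N : ℕ} (hN : ∀ l, SuppIn N (a l))
    {φ : ℝ → ℂ} (h : IsLimitFunction M m a dirac φ) {j : ℕ} (hj : j ≤ m) {y : ℝ}
    (hy : (N : ℝ) + m + 1 < |y|) : iteratedDeriv j φ y = 0 := by
  refine tendsto_nhds_unique (h.tendsto_floor hM hj y) (tendsto_const_nhds.congr fun n => ?_)
  rw [backDiff_qsData_dirac_floor_eq_zero hM hN hj n hy, mul_zero]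

theorem IsLimitFunction.eq_zero (hM : 2 ≤ M) {N : ℕ} (hN : ∀ l, SuppIn N (a l))
    {φ : ℝ → ℂ} (h : IsLimitFunction M m a dirac φ) {y : ℝ}
    (hy : (N : ℝ) + m + 1 < |y|) : φ y = 0 := by
  simpa using h.iteratedDeriv_eq_zero hM hN (Nat.zero_le m) hy

/-- Outside a fixed multiple of M^n both the differences of the δ data and the derivative of φ
vanish, so the restriction to |k| ≤ M^n K disappears. -/
theorem IsLimitFunction.uniform (hM : 2 ≤ M) {N : ℕ} (hN : ∀ l, SuppIn N (a l))
    {φ : ℝ → ℂ} (h : IsLimitFunction M m a dirac φ) {j : ℕ} (hj : j ≤ m) {ε : ℝ} (hε : 0 < ε) :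
    ∃ n₀ : ℕ, ∀ n, n₀ ≤ n → ∀ k : ℤ, ‖(M : ℂ) ^ (j * n) * backDiff^[j] (qsData M a dirac n) k
      - iteratedDeriv j φ ((k : ℝ) / (M : ℝ) ^ n)‖ ≤ ε := by
  have hM0 : (0 : ℝ) < M := by exact_mod_cast (by omega : 0 < M)
  obtain ⟨n₀, hn₀⟩ := h.2 ((N : ℝ) + m + 1) (by positivity) j hj ε hε
  refine ⟨n₀, fun n hn k => ?_⟩
  by_cases hk : |(k : ℝ)| ≤ (M : ℝ) ^ n * (N + m + 1)
  · exact hn₀ n hn k hk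
  · have hp : (0 : ℝ) < (M : ℝ) ^ n := by positivity
    rw [not_le] at hk
    rw [h.iteratedDeriv_eq_zero hM hN hj, backDiff_qsData_dirac_eq_zero hM hN hj]
    · simpa using hε.le
    · linarith
    · rwa [abs_div, abs_of_pos hp, lt_div_iff₀ hp, mul_comm]

theorem IsLimitFunction.hasCompactSupport (hM : 2 ≤ M)
    (ha : ∀ l, (Function.support (a l)).Finite) {φ : ℝ → ℂ}
    (h : IsLimitFunction M m a dirac φ) : HasCompactSupport φ := by
  obtain ⟨N, hN⟩ := exists_suppIn_family ha
  refine HasCompactSupport.of_support_subset_isCompact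
    (isCompact_Icc (a := -((N : ℝ) + m + 1)) (b := (N : ℝ) + m + 1)) fun y hy => ?_
  rw [Set.mem_Icc, ← abs_le]
  by_contra hlt
  exact hy (h.eq_zero hM hN (not_le.mp hlt))

theorem IsLimitFunction.eq_shiftSum (hM : 2 ≤ M) (ha : ∀ l, (Function.support (a l)).Finite)
    {φ : ℝ → ℂ} (h : IsLimitFunction M m a dirac φ) {v : ℤ → ℂ} {η : ℝ → ℂ}
    (hv : IsLimitFunction M m a v η) (x : ℝ) : η x = shiftSum v φ x := by
  obtain ⟨N, hN⟩ := exists_suppIn_family ha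
  have h1 := hv.tendsto_floor hM (Nat.zero_le m) x
  simp only [zero_mul, pow_zero, one_mul, Function.iterate_zero, id_eq, iteratedDeriv_zero] at h1
  obtain ⟨T, hT⟩ := exists_nat_ge (|x| + ((N : ℝ) + m + 1))
  rw [shiftSum_eq_sum (fun y hy => h.eq_zero hM hN hy) v hT]
  have h2 : ∀ n, qsData M a v n ⌊(M : ℝ) ^ n * x⌋ =
      ∑ i ∈ Finset.Icc (-(T : ℤ)) T, v i * qsData M a dirac n ⌊(M : ℝ) ^ n * (x - i)⌋ := by
    intro n
    have hfl : ∀ i : ℤ, ⌊(M : ℝ) ^ n * x⌋ - (M : ℤ) ^ n * i = ⌊(M : ℝ) ^ n * (x - i)⌋ := by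
      intro i
      rw [← Int.floor_sub_intCast]
      congr 1; push_cast; ring
    rw [qsData_eq_tsum (by omega) ha, tsum_eq_sum (s := Finset.Icc (-(T : ℤ)) T)]
    · exact Finset.sum_congr rfl fun i _ => by rw [hfl]
    · intro i hi
      have h3 := backDiff_qsData_dirac_floor_eq_zero hM hN (Nat.zero_le m) n (y := x - i) (by
        rw [Finset.mem_Icc, ← abs_le, not_le] at hi
        have hi' : (T : ℝ) < |(i : ℝ)| := by exact_mod_cast hi
        have := abs_sub_abs_le_abs_sub (i : ℝ) x
        rw [abs_sub_comm] at this
        linarith)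
      rw [hfl]
      simp only [Function.iterate_zero, id_eq] at h3
      rw [h3, mul_zero]
  simp only [h2] at h1
  refine tendsto_nhds_unique h1 (tendsto_finsetSum _ fun i _ => ?_)
  have h4 := h.tendsto_floor hM (Nat.zero_le m) (x - i)
  simp only [zero_mul, pow_zero, one_mul, Function.iterate_zero, id_eq, iteratedDeriv_zero] at h4
  exact h4.const_mul (v i)

theorem norm_exp_neg_I_mul (x ξ : ℝ) : ‖Complex.exp (-(Complex.I * (x : ℂ) * (ξ : ℂ)))‖ = 1 := by
  rw [Complex.norm_exp]
  simp

/-- The scaled symbol at e^(-iξ/M^n) is a Riemann sum, with mesh M^(-n), for the Fourier integral of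
φ. -/
theorem IsLimitFunction.tendsto_fourier (hM : 2 ≤ M)
    (ha : ∀ l, (Function.support (a l)).Finite) {φ : ℝ → ℂ}
    (h : IsLimitFunction M m a dirac φ) (ξ : ℝ) :
    Tendsto (fun n : ℕ => ((M : ℂ) ^ n)⁻¹ * symbol (qsData M a dirac n)
      (Complex.exp (-(Complex.I * ((ξ / (M : ℝ) ^ n : ℝ) : ℂ))))) atTop
      (𝓝 (∫ x : ℝ, φ x * Complex.exp (-(Complex.I * (x : ℂ) * (ξ : ℂ))))) := by
  obtain ⟨N, hN⟩ := exists_suppIn_family ha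
  have hc : Continuous φ := h.1.continuous
  refine (tendsto_riemann_sum hM (R := N + m + 1)
    (g := fun x => φ x * Complex.exp (-(Complex.I * (x : ℂ) * (ξ : ℂ))))
    (d := fun n k => qsData M a dirac n k *
      Complex.exp (-(Complex.I * (((k : ℝ) / (M : ℝ) ^ n : ℝ) : ℂ) * (ξ : ℂ))))
    (by fun_prop) ?_ ?_ ?_).congr fun n => ?_
  · intro y hy
    rw [h.eq_zero hM hN (by push_cast at hy; exact hy), zero_mul]
  · intro n k hk
    simp only
    rw [(suppIn_qsData_dirac hM hN n).mono (Nat.mul_le_mul_right _ (by omega)) k hk, zero_mul]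
  · intro ε hε
    obtain ⟨n₀, hn₀⟩ := h.uniform hM hN (Nat.zero_le m) hε
    refine ⟨n₀, fun n hn k => ?_⟩
    have h1 := hn₀ n hn k
    simp only [zero_mul, pow_zero, one_mul, Function.iterate_zero, id_eq,
      iteratedDeriv_zero] at h1
    rw [← sub_mul, norm_mul, norm_exp_neg_I_mul, mul_one]
    exact h1
  · congr 1
    refine tsum_congr fun k => ?_
    rw [← Complex.exp_int_mul]
    congr 2
    push_cast
    ring

/-- Along the levels rq the symbol of the data factors into values of the composite symbol, so the
Riemann sums are the partial products. -/
theorem IsLimitFunction.isRefinableFunction (hM : 2 ≤ M)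
    (ha : ∀ l, (Function.support (a l)).Finite) {φ : ℝ → ℂ}
    (h : IsLimitFunction M m a dirac φ) :
    IsRefinableFunction (M ^ r) (compositeMask M a) φ := by
  have hM0 : 0 < M := by omega
  have hMr : ((M ^ r : ℕ) : ℂ) ≠ 0 := by exact_mod_cast (pow_pos hM0 r).ne'
  refine ⟨h.1.continuous.integrable_of_hasCompactSupport (h.hasCompactSupport hM ha), fun ξ => ?_⟩
  have h1 := (h.tendsto_fourier hM ha ξ).comp
    (tendsto_id.const_mul_atTop' (NeZero.pos r) : Tendsto (fun q : ℕ => r * q) atTop atTop)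
  refine h1.congr fun q => ?_
  have hA := finite_support_compositeMask (M := M) ha
  simp only [Function.comp_apply]
  induction q with
  | zero => simp only [mul_zero, pow_zero, qsData, symbol_dirac, Finset.range_zero,
      Finset.prod_empty, inv_one, mul_one]
  | succ q ih =>
    rw [Finset.prod_range_succ, ← ih, ← subdiv_compositeMask_iterate hM0 ha,
      ← subdiv_compositeMask_iterate hM0 ha, Function.iterate_succ_apply',
      symbol_subdiv _ hA (finite_support_subdiv_iterate hA q) (Complex.exp_ne_zero _),
      ← Complex.exp_nat_mul]
    have e1 : ((M ^ r : ℕ) : ℂ) * -(Complex.I * ((ξ / (M : ℝ) ^ (r * (q + 1)) : ℝ) : ℂ)) =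
        -(Complex.I * ((ξ / (M : ℝ) ^ (r * q) : ℝ) : ℂ)) := by
      push_cast
      have : (M : ℂ) ≠ 0 := by exact_mod_cast hM0.ne'
      field_simp
      ring
    have e2 : (((M ^ r : ℕ) : ℝ)) ^ (q + 1) = (M : ℝ) ^ (r * (q + 1)) := by
      rw [Nat.cast_pow, ← pow_mul]
    have e3 : (M : ℂ) ^ (r * (q + 1)) = (M : ℂ) ^ (r * q) * ((M ^ r : ℕ) : ℂ) := by
      rw [mul_add, mul_one, pow_add, Nat.cast_pow]
    rw [e1, e2, e3, mul_inv]
    field_simp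

/-- The data have mass M^n, so φ has integral 1. If a derivative vanished identically, the preceding
one would be constant and, by compact support, zero. -/
theorem IsLimitFunction.iteratedDeriv_ne_zero (hM : 2 ≤ M)
    (ha : ∀ l, (Function.support (a l)).Finite) (hsum : ∀ l, ∑' k : ℤ, a l k = 1) {φ : ℝ → ℂ}
    (h : IsLimitFunction M m a dirac φ) {j : ℕ} (hj : j ≤ m) : ∃ x, iteratedDeriv j φ x ≠ 0 := by
  obtain ⟨N, hN⟩ := exists_suppIn_family ha
  have hMc : (M : ℂ) ≠ 0 := by exact_mod_cast (by omega : M ≠ 0)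
  induction j with
  | zero =>
    by_contra! h0
    have h1 := h.tendsto_fourier hM ha 0
    simp only [iteratedDeriv_zero] at h0
    simp only [h0, zero_mul, MeasureTheory.integral_zero, zero_div, Complex.ofReal_zero, mul_zero,
      neg_zero, Complex.exp_zero, symbol_one, tsum_qsData_dirac ha hsum] at h1
    refine one_ne_zero (tendsto_nhds_unique (tendsto_const_nhds.congr fun n => ?_) h1)
    rw [inv_mul_cancel₀ (pow_ne_zero n hMc)]
  | succ j ih =>
    by_contra! h0
    obtain ⟨x, hx⟩ := ih (by omega)
    refine hx ?_
    have hd : Differentiable ℝ (iteratedDeriv j φ) :=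
      h.1.differentiable_iteratedDeriv j (by exact_mod_cast hj)
    simp only [iteratedDeriv_succ] at h0
    rw [is_const_of_deriv_eq_zero hd h0 x ((N : ℝ) + m + 2)]
    refine h.iteratedDeriv_eq_zero hM hN (by omega) ?_
    rw [abs_of_nonneg (by positivity)]
    linarith

end scheme

/-! ### Necessity of the conditions -/

section scheme

variable {r : ℕ} [NeZero r] {M m : ℕ} {a : Fin r → ℤ → ℂ}

/-- Near x all rescaled j-th differences tend to φ^(j)(x). Passing to the limit in one refinement
step at residue g gives φ^(j)(x) = φ^(j)(x) M^(j+1) (coset sum of the quotient at g), and φ^(j)(x) ≠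
0 can be cancelled. -/
theorem IsLimitFunction.hasSumRules_succ (hM : 2 ≤ M)
    (ha : ∀ l, (Function.support (a l)).Finite) (hsum : ∀ l, ∑' k : ℤ, a l k = 1) {φ : ℝ → ℂ}
    (h : IsLimitFunction M m a dirac φ) {j : ℕ} (hj : j ≤ m)
    (hs : ∀ l, HasSumRules (a l) M j) (l : Fin r) : HasSumRules (a l) M (j + 1) := by
  have hM0 : 0 < M := by omega
  have hMR : (0 : ℝ) < M := by exact_mod_cast hM0
  obtain ⟨b, hb, hab⟩ := (hasSumRules_iff (ha l) M j).mp (hs l)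
  obtain ⟨N, hN⟩ := exists_suppIn hb
  obtain ⟨x, hx⟩ := h.iteratedDeriv_ne_zero hM ha hsum hj
  have hcoset : ∀ k : ℤ, ∑' i : ℤ, b (k - M * i) = ((M : ℂ) ^ (j + 1))⁻¹ := by
    intro k
    obtain ⟨q₀, g, hg0, hg, rfl⟩ := int_eq_mul_add hM0 k
    have h1 := tsum_conv_eq hM0 (hN.mul_right hM0) (fun _ => 1) q₀ hg0 hg
    simp only [one_mul] at h1
    rw [h1]
    set w : ℕ → ℤ → ℂ := fun n k => (M : ℂ) ^ (j * n) * backDiff^[j] (qsData M a dirac n) k with hw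
    have hfl := tendsto_floor_mul_pow_div hM x
    have hinv : Tendsto (fun n : ℕ => ((M : ℝ) ^ n)⁻¹) atTop (𝓝 0) :=
      (tendsto_pow_atTop_atTop_of_one_lt
        (by exact_mod_cast (by omega : 1 < M) : (1 : ℝ) < M)).inv_tendsto_atTop
    have hlim : ∀ i : ℤ, Tendsto (fun n : ℕ => w n (⌊(M : ℝ) ^ n * x⌋ - i)) atTop
        (𝓝 (iteratedDeriv j φ x)) := by
      intro i
      refine h.tendsto_of_div_tendsto hM0 hj ?_
      have h2 := hfl.sub (hinv.const_mul (i : ℝ))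
      rw [mul_zero, sub_zero] at h2
      refine h2.congr fun n => ?_
      push_cast
      field_simp
    have hlim1 : Tendsto (fun n : ℕ => w (n + 1) (M * ⌊(M : ℝ) ^ n * x⌋ + g)) atTop
        (𝓝 (iteratedDeriv j φ x)) := by
      -- The truncated n - 1 at n = 0 is harmless: the limit is taken after shifting the index by
      -- one.
      have h2 : Tendsto (fun n : ℕ =>
          ((M * ⌊(M : ℝ) ^ (n - 1) * x⌋ + g : ℤ) : ℝ) / (M : ℝ) ^ n) atTop (𝓝 x) := by
        rw [← tendsto_add_atTop_iff_nat 1]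
        have h3 := hfl.add (hinv.const_mul ((g : ℝ) / M))
        rw [mul_zero, add_zero] at h3
        refine h3.congr fun n => ?_
        rw [Nat.add_sub_cancel]
        push_cast
        field_simp
        ring
      have h4 := (tendsto_add_atTop_iff_nat 1).mpr (h.tendsto_of_div_tendsto hM0 hj h2)
      simpa using h4
    -- These are the levels at which the mask with index l is applied next.
    have hsub : Tendsto (fun t : ℕ => r * t + l) atTop atTop :=
      tendsto_atTop_mono (fun t => Nat.le_add_right _ _) (tendsto_id.const_mul_atTop' (NeZero.pos r))
    have hlim2 : Tendsto (fun n : ℕ => (M : ℂ) ^ (j + 1) * ∑ i ∈ Finset.Icc (-(N : ℤ)) N,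
        w n (⌊(M : ℝ) ^ n * x⌋ - i) * b (M * i + g)) atTop
        (𝓝 ((M : ℂ) ^ (j + 1) * ∑ i ∈ Finset.Icc (-(N : ℤ)) N,
          iteratedDeriv j φ x * b (M * i + g))) :=
      (tendsto_finsetSum _ fun i _ => (hlim i).mul_const _).const_mul _
    have heq := tendsto_nhds_unique (hlim1.comp hsub) ((hlim2.comp hsub).congr fun t => by
      have hl : Fin.ofNat r (r * t + l) = l := by
        ext
        simp [Nat.mod_eq_of_lt l.isLt]
      simp only [Function.comp_apply, hw]
      rw [qsData, hl, hab, backDiff_iterate_subdiv_box hM0 hb, subdiv,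
        tsum_conv_eq hM0 (hN.mul_right hM0) _ _ hg0 hg]
      simp only [Finset.mul_sum]
      refine Finset.sum_congr rfl fun i _ => ?_
      ring)
    rw [← Finset.mul_sum, mul_left_comm] at heq
    exact eq_inv_of_mul_eq_one_right (mul_left_cancel₀ hx (by rw [mul_one]; exact heq.symm))
  obtain ⟨c, hc, hbc⟩ := exists_box_of_tsum_coset hM0 hb hcoset
  rw [hasSumRules_iff (ha l)]
  exact ⟨c, hc, by rw [Function.iterate_succ_apply, ← hbc, hab]⟩

theorem IsLimitFunction.hasSumRules (hM : 2 ≤ M)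
    (ha : ∀ l, (Function.support (a l)).Finite) (hsum : ∀ l, ∑' k : ℤ, a l k = 1) {φ : ℝ → ℂ}
    (h : IsLimitFunction M m a dirac φ) (l : Fin r) : HasSumRules (a l) M (m + 1) := by
  have key : ∀ j ≤ m + 1, ∀ l, HasSumRules (a l) M j := by
    intro j
    induction j with
    | zero => exact fun _ l => ⟨a l, ha l, fun z _ => by simp⟩
    | succ j ih => exact fun hj => h.hasSumRules_succ hM ha hsum (by omega) (ih (by omega))
  exact key _ le_rfl l

/-- Neighbouring rescaled m-th differences are both close to values of φ^(m) at points M^(-n) apart,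
and φ^(m) is uniformly continuous. -/
theorem IsLimitFunction.backDiff_small (hM : 2 ≤ M)
    (ha : ∀ l, (Function.support (a l)).Finite) {φ : ℝ → ℂ}
    (h : IsLimitFunction M m a dirac φ) {ε : ℝ} (hε : 0 < ε) :
    ∃ n₀ : ℕ, ∀ n, n₀ ≤ n → ∀ k,
      (M : ℝ) ^ (m * n) * ‖backDiff^[m + 1] (qsData M a dirac n) k‖ ≤ ε := by
  have hM1 : (1 : ℝ) < M := by exact_mod_cast (by omega : 1 < M)
  obtain ⟨N, hN⟩ := exists_suppIn_family ha
  have hcs : HasCompactSupport (iteratedDeriv m φ) := by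
    refine HasCompactSupport.of_support_subset_isCompact
      (isCompact_Icc (a := -((N : ℝ) + m + 1)) (b := (N : ℝ) + m + 1)) fun y hy => ?_
    rw [Set.mem_Icc, ← abs_le]
    by_contra hlt
    exact hy (h.iteratedDeriv_eq_zero hM hN le_rfl (not_le.mp hlt))
  have huc := hcs.uniformContinuous_of_continuous (h.continuous_iteratedDeriv le_rfl)
  obtain ⟨δ, hδ, hδ2⟩ := Metric.uniformContinuous_iff.mp huc (ε / 3) (by positivity)
  obtain ⟨n₀, hn₀⟩ := h.uniform hM hN le_rfl (by positivity : 0 < ε / 3)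
  have hinv : Tendsto (fun n : ℕ => ((M : ℝ) ^ n)⁻¹) atTop (𝓝 0) :=
    (tendsto_pow_atTop_atTop_of_one_lt hM1).inv_tendsto_atTop
  obtain ⟨n₁, hn₁⟩ := eventually_atTop.mp (hinv.eventually (gt_mem_nhds hδ))
  refine ⟨max n₀ n₁, fun n hn k => ?_⟩
  have hp : (0 : ℝ) < (M : ℝ) ^ n := by positivity
  have h1 := hn₀ n (le_of_max_le_left hn) k
  have h2 := hn₀ n (le_of_max_le_left hn) (k - 1)
  have h3 : dist (iteratedDeriv m φ ((k : ℝ) / (M : ℝ) ^ n))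
      (iteratedDeriv m φ (((k - 1 : ℤ) : ℝ) / (M : ℝ) ^ n)) < ε / 3 := by
    refine hδ2 ?_
    rw [Real.dist_eq, ← sub_div]
    push_cast
    rw [sub_sub_cancel, one_div, abs_of_pos (by positivity)]
    exact hn₁ n (le_of_max_le_right hn)
  rw [dist_eq_norm] at h3
  set A := (M : ℂ) ^ (m * n) * backDiff^[m] (qsData M a dirac n) k
  set B := (M : ℂ) ^ (m * n) * backDiff^[m] (qsData M a dirac n) (k - 1)
  set x := iteratedDeriv m φ ((k : ℝ) / (M : ℝ) ^ n)
  set y := iteratedDeriv m φ (((k - 1 : ℤ) : ℝ) / (M : ℝ) ^ n)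
  have h4 : (M : ℝ) ^ (m * n) * ‖backDiff^[m + 1] (qsData M a dirac n) k‖ = ‖A - B‖ := by
    rw [Function.iterate_succ_apply']
    simp only [A, B, ← mul_sub]
    rw [norm_mul, norm_pow, Complex.norm_natCast]
    rfl
  rw [h4, show A - B = (A - x) + (x - y) + (y - B) by ring]
  rw [norm_sub_rev] at h2
  exact norm_add₃_le.trans (by linarith)

theorem IsLimitFunction.exists_decay (hM : 2 ≤ M)
    (ha : ∀ l, (Function.support (a l)).Finite) (hsum : ∀ l, ∑' k : ℤ, a l k = 1) {φ : ℝ → ℂ}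
    (h : IsLimitFunction M m a dirac φ) :
    ∃ ρ C : ℝ, 0 < ρ ∧ ρ < (((M ^ r : ℕ) : ℝ) ^ m)⁻¹ ∧
      ∀ q k, ‖backDiff^[m + 1] (qsData M a dirac (r * q)) k‖ ≤ C * ρ ^ q := by
  have hM0 : 0 < M := by omega
  have hMR : (0 : ℝ) < M := by exact_mod_cast hM0
  choose c hc hac using fun l => (hasSumRules_iff (ha l) M (m + 1)).mp
    (h.hasSumRules hM ha hsum l)
  obtain ⟨N, hN⟩ := exists_suppIn_family hc
  have hdiff : ∀ n, backDiff^[m + 1] (qsData M a dirac n) =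
      qsData M c (backDiff^[m + 1] dirac) n := by
    intro n
    rw [show a = fun l => (box M)^[m + 1] (c l) from funext hac]
    exact backDiff_iterate_qsData_box hM0 hc _ _ _
  set D : ℝ := (2 * (N + (m + 1 : ℕ)) + 1) ^ (m + 1) with hD
  have hD0 : 0 < D := by positivity
  -- Makes (2N + 1) D ε = 1/2. D bounds the cost of undoing m + 1 differences and is independent of
  -- the level, so ε can be fixed before s.
  set ε : ℝ := 1 / (2 * ((2 * N + 1) * D)) with hε
  obtain ⟨n₀, hn₀⟩ := h.backDiff_small hM ha (by positivity : 0 < ε)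
  -- At least n₀, and a whole number of periods, so that the s-step contraction can be iterated.
  set s := r * (n₀ + 1) with hs
  have hsn : n₀ ≤ s := by
    have := Nat.le_mul_of_pos_left (n₀ + 1) (NeZero.pos r)
    omega
  have hMs : (0 : ℝ) < (M : ℝ) ^ (m * s) := by positivity
  have hcs : ∀ k, ‖qsData M c dirac s k‖ ≤ D * (ε / (M : ℝ) ^ (m * s)) := by
    refine norm_le_of_shiftDiff_iterate_le (pow_pos hM0 s) (m + 1)
      (suppIn_qsData_dirac hM hN s) fun k => ?_
    rw [← qsData_backDiff_iterate hM0 hc, ← hdiff, le_div_iff₀' hMs]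
    exact hn₀ s hsn k
  have hcontr : ∀ (v : ℤ → ℂ) (E : ℝ), (∀ k, ‖v k‖ ≤ E) →
      ∀ k, ‖qsData M c v s k‖ ≤ E / 2 / (M : ℝ) ^ (m * s) := by
    intro v E hE k
    rw [qsData_eq_tsum hM0 hc]
    have h1 := norm_tsum_conv_le (pow_pos hM0 s) (suppIn_qsData_dirac hM hN s) hcs hE k
    push_cast at h1
    refine h1.trans_eq ?_
    rw [hε]
    field_simp
  -- Normalized by the critical rate M^(rm) per period, the norms halve every n₀ + 1 periods; this
  -- gives a rate strictly below the critical one.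
  set e : ℕ → ℝ := fun q => supNorm (backDiff^[m + 1] (qsData M a dirac (r * q)))
    * (((M ^ r : ℕ) : ℝ) ^ m) ^ q with he
  have hfin : ∀ n, (Function.support (backDiff^[m + 1] (qsData M a dirac n))).Finite := fun n =>
    finite_support_backDiff_iterate (finite_support_qsData ha finite_support_dirac n) _
  have hLm : (0 : ℝ) < ((M ^ r : ℕ) : ℝ) ^ m := by
    rw [Nat.cast_pow]; positivity
  obtain ⟨σ, C, hσ0, hσ1, hC⟩ := exists_geometric_bound (d := e) (p := n₀ + 1)
    (fun q => mul_nonneg (supNorm_nonneg _) (by positivity)) (by omega) (fun q => by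
      have h1 : supNorm (backDiff^[m + 1] (qsData M a dirac (r * (q + (n₀ + 1))))) ≤
          supNorm (backDiff^[m + 1] (qsData M a dirac (r * q))) / 2 / (M : ℝ) ^ (m * s) := by
        refine supNorm_le fun k => ?_
        rw [mul_add, hdiff, qsData_period, ← hdiff]
        exact hcontr _ _ (norm_le_supNorm (hfin _)) k
      have h2 : (((M ^ r : ℕ) : ℝ) ^ m) ^ (q + (n₀ + 1)) =
          (((M ^ r : ℕ) : ℝ) ^ m) ^ q * (M : ℝ) ^ (m * s) := by
        rw [pow_add, Nat.cast_pow, hs]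
        congr 1
        rw [← pow_mul, ← pow_mul]
        congr 1; ring
      calc e (q + (n₀ + 1)) ≤ supNorm (backDiff^[m + 1] (qsData M a dirac (r * q))) / 2
            / (M : ℝ) ^ (m * s) * ((((M ^ r : ℕ) : ℝ) ^ m) ^ q * (M : ℝ) ^ (m * s)) := by
            simp only [he]
            rw [h2]
            gcongr
        _ = e q / 2 := by
            simp only [he]
            field_simp)
  refine ⟨σ * (((M ^ r : ℕ) : ℝ) ^ m)⁻¹, C, by positivity, ?_, fun q k => ?_⟩
  · exact mul_lt_of_lt_one_left (by positivity) hσ1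
  · refine (norm_le_supNorm (hfin _) k).trans ?_
    rw [mul_pow, inv_pow, ← mul_assoc, ← div_eq_mul_inv, le_div_iff₀ (by positivity)]
    exact hC q

end scheme

end Subdivision

theorem theorem1p2 (M : ℕ) (hM : 2 ≤ M) (r : ℕ) [NeZero r] (m : ℕ)
    (a : Fin r → ℤ → ℂ)
    (ha_supp : ∀ l : Fin r, (Function.support (a l)).Finite)
    (ha_sum : ∀ l : Fin r, ∑' k : ℤ, a l k = 1) :
    (Subdivision.IsConvergent M m a ↔
      (m : ℝ) < Subdivision.smInf (Subdivision.compositeMask M a) (M ^ r) ∧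
        ∀ l : Fin r, m < Subdivision.sr (a l) M) ∧
    (Subdivision.IsConvergent M m a →
      ∃ φ : ℝ → ℂ, ContDiff ℝ m φ ∧ HasCompactSupport φ ∧
        Subdivision.IsRefinableFunction (M ^ r) (Subdivision.compositeMask M a) φ ∧
        ∀ (v : ℤ → ℂ) (η : ℝ → ℂ), Subdivision.IsLimitFunction M m a v η →
          ∀ x : ℝ, η x = ∑' k : ℤ, v k * φ (x - (k : ℝ))) := by
  have hM0 : 0 < M := by omega
  have hsr : ∀ l, m < Subdivision.sr (a l) M ↔ Subdivision.HasSumRules (a l) M (m + 1) :=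
    fun l => Subdivision.lt_sr_iff hM (ha_supp l) (Subdivision.ne_zero_of_tsum (ha_sum l)) m
  refine ⟨⟨fun hconv => ?_, fun ⟨hsm, hs⟩ => ?_⟩, fun hconv => ?_⟩
  · obtain ⟨φ, hφ⟩ := hconv Subdivision.dirac
    have hs := hφ.hasSumRules hM ha_supp ha_sum
    obtain ⟨ρ, C, hρ0, hρ, hC⟩ := hφ.exists_decay hM ha_supp ha_sum
    refine ⟨?_, fun l => (hsr l).mpr (hs l)⟩
    refine Subdivision.lt_smInf_of_decay (C := C)
      (hM.trans (Nat.le_self_pow (NeZero.ne r) M))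
      (Subdivision.finite_support_compositeMask ha_supp)
      (Subdivision.tsum_compositeMask hM0 ha_supp ha_sum)
      (Subdivision.hasSumRules_compositeMask hM0 ha_supp hs) hρ0 hρ fun q k => ?_
    rw [Subdivision.subdiv_compositeMask_iterate hM0 ha_supp]
    exact hC q k
  · have hs' := fun l => (hsr l).mp (hs l)
    obtain ⟨θ, C, hθ0, hθ, hC⟩ :=
      Subdivision.exists_decay_of_smInf_sr hM ha_supp ha_sum hsm hs'
    exact Subdivision.isConvergent_of_decay hM ha_supp ha_sum hs' hθ0 hθ hC
  · obtain ⟨φ, hφ⟩ := hconv Subdivision.dirac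
    exact ⟨φ, hφ.1, hφ.hasCompactSupport hM ha_supp, hφ.isRefinableFunction hM ha_supp,
      fun v η hη x => hφ.eq_shiftSum hM ha_supp hη x⟩
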